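/- **Model.** Consider the power network with six nodes (cities) and eight lines in which two nodes are each joined to all four other nodes by a line, there are no other lines, and all susceptances are $1$. For a set $R$ of removed lines let $V_R=C_RL_R^{+}$, where $C_R$ is the edge–vertex incidence matrix of the remaining network (some fixed orientation), $L_R=C_R^{\top}C_R$ its Laplacian and $L_R^{+}$ the Moore–Penrose pseudo-inverse; with generation $g$ and demand $d$ the line flows are $f=V_R(g-d)$. Put $V=V_\emptyset$. The components of the remaining network are called islands. Let the city sizes $X=(X_1,\dots,X_6)$ be i.i.d. non-negative random variables with $\mathbb P(X_i>x)\sim Kx^{-\alpha}$ as $x\to\infty$, where $K,\alpha>0$ (for example, Pareto distributed), and let the first failing line $\ell$ be uniformly distributed over the eight lines and independent of $X$. Fix a loading factor $\lambda\in(0,1)$. The demand is $X$, and the initial generation $g$ is the minimizer of $\frac12\sum_i g_i^2$ subject to $\sum_i g_i=\sum_i X_i$ and $|V(g-X)|\le\lambda|VX|$ (componentwise). The emergency limit of line $j$ is $F_j=|(VX)_j|$. After the failure of $\ell$, and after each later failure, power balance is restored in every island: in an island whose total generation is less than its total demand all demands are multiplied by the same factor so that the totals agree, and in an island whose total generation is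 at least its total demand all generations are multiplied by the same factor so that the totals agree. The flows $f$ of the remaining network are then recomputed, and the next line to fail is, among the surviving lines $j$ with $|f_j|\ge F_j$, one for which $|f_j|/F_j$ is largest (ties may be broken in any way, also at random). The cascade stops when there is no such line. The blackout size is $$S=\Bigl|\sum_{i\in A_1}(X_i-g_i)\Bigr|,$$ where $A_1$ is the island of the largest city at the end of the cascade and $g$ is the initial generation. **Statement.** If $\lambda\in(0,1/4)$, then $\mathbb P(S>x)=O(x^{-2\alpha})$ as $x\to\infty$. If $\lambda$ lies in one of the intervals $(1/4,3/8)$, $(3/8,1/2)$, $(1/2,3/4)$, $(3/4,1)$, then $$\mathbb P(S>x)\sim C(\lambda)\,K\,x^{-\alpha}\qquad(x\to\infty),$$ where $$C(\lambda)=\begin{cases}(\lambda/6)^\alpha & \text{if } 1/4<\lambda<3/8,\\ (\lambda/6)^\alpha+(2\lambda/3)^\alpha & \text{if } 3/8<\lambda<1/2,\\ 4(\lambda/6)^\alpha+(2\lambda/3)^\alpha & \text{if } 1/2<\lambda<3/4,\\ 4(\lambda/6)^\alpha+(\lambda/3)^\alpha+(2\lambda/3)^\alpha & \text{if } 3/4<\lambda<1.\end{cases}$$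 Setting $C(\lambda)=0$ for $\lambda\in(0,1/4)$, the phase transitions, that is, the points $t\in(0,1)$ at which $\lim_{\lambda\to t,\,\lambda\ne t}C(\lambda)$ does not exist, are exactly $t=1/4,\ 3/8,\ 1/2,\ 3/4$. -/

import Mathlib

open Set Filter Topology MeasureTheory ProbabilityTheory Asymptotics
open scoped Matrix

noncomputable section

/-! ### The Moore-Penrose pseudo-inverse -/

/-- The four Penrose equations: `P` is the Moore-Penrose pseudo-inverse of the real matrix `A`. -/
structure IsMoorePenrose {n : Type*} [Fintype n] (A P : Matrix n n ℝ) : Prop where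
  mul_mul_left : A * P * A = A
  mul_mul_right : P * A * P = P
  symm_left : (A * P)ᵀ = A * P
  symm_right : (P * A)ᵀ = P * A

theorem IsMoorePenrose.unique {n : Type*} [Fintype n] {A P Q : Matrix n n ℝ}
    (hP : IsMoorePenrose A P) (hQ : IsMoorePenrose A Q) : P = Q := by
  have h1 : A * P = A * Q := by
    calc A * P = (A * Q * A) * P := by rw [hQ.mul_mul_left]
      _ = (A * Q) * (A * P) := by simp only [Matrix.mul_assoc]
      _ = (A * Q)ᵀ * (A * P)ᵀ := by rw [hQ.symm_left, hP.symm_left]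
      _ = (A * P * A * Q)ᵀ := by
        rw [← Matrix.transpose_mul]; simp only [Matrix.mul_assoc]
      _ = A * Q := by rw [hP.mul_mul_left, hQ.symm_left]
  have h2 : P * A = Q * A := by
    calc P * A = P * (A * Q * A) := by rw [hQ.mul_mul_left]
      _ = (P * A) * (Q * A) := by simp only [Matrix.mul_assoc]
      _ = (P * A)ᵀ * (Q * A)ᵀ := by rw [hQ.symm_right, hP.symm_right]
      _ = (Q * (A * P * A))ᵀ := by
        rw [← Matrix.transpose_mul]; simp only [Matrix.mul_assoc]
      _ = Q * A := by rw [hP.mul_mul_left, hQ.symm_right]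
  calc P = P * A * P := hP.mul_mul_right.symm
    _ = Q * (A * P) := by rw [h2, Matrix.mul_assoc]
    _ = Q * A * Q := by rw [h1, Matrix.mul_assoc]
    _ = Q := hQ.mul_mul_right

theorem exists_isMoorePenrose {n : Type*} [Fintype n] {A : Matrix n n ℝ} (hA : Aᵀ = A) :
    ∃ P, IsMoorePenrose A P := by
  classical
  have hH : A.IsHermitian := by
    rw [Matrix.IsHermitian, Matrix.conjTranspose_eq_transpose_of_trivial, hA]
  set φ := Unitary.conjStarAlgAut ℝ (Matrix n n ℝ) hH.eigenvectorUnitary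
  set D : Matrix n n ℝ := Matrix.diagonal hH.eigenvalues
  set D' : Matrix n n ℝ := Matrix.diagonal (fun i => (hH.eigenvalues i)⁻¹)
  have hφ : A = φ D := hH.spectral_theorem
  have ht : ∀ M : Matrix n n ℝ, (φ M)ᵀ = φ Mᵀ := fun M => by
    have := map_star φ M
    simpa [Matrix.star_eq_conjTranspose] using this.symm
  refine ⟨φ D', ?_, ?_, ?_, ?_⟩
  · rw [hφ, ← map_mul, ← map_mul]
    congr 1
    simp only [D, D', Matrix.diagonal_mul_diagonal, mul_inv_mul_cancel]
  · rw [hφ, ← map_mul, ← map_mul]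
    congr 1
    simp only [D, D', Matrix.diagonal_mul_diagonal]
    congr 1
    funext i
    simpa using mul_inv_mul_cancel (hH.eigenvalues i)⁻¹
  · rw [hφ, ← map_mul, ht]
    simp [D, D', Matrix.diagonal_mul_diagonal]
  · rw [hφ, ← map_mul, ht]
    simp [D, D', Matrix.diagonal_mul_diagonal]

open Classical in
/-- The Moore-Penrose pseudo-inverse `A⁺` (it exists and is unique for every symmetric `A`). -/
def pseudoInverse {n : Type*} [Fintype n] (A : Matrix n n ℝ) : Matrix n n ℝ :=
  if h : ∃ P, IsMoorePenrose A P then h.choose else 0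

theorem isMoorePenrose_pseudoInverse {n : Type*} [Fintype n] {A : Matrix n n ℝ} (hA : Aᵀ = A) :
    IsMoorePenrose A (pseudoInverse A) := by
  have h := exists_isMoorePenrose hA
  rw [pseudoInverse, dif_pos h]
  exact h.choose_spec

/-! ### Power networks and the DC power flow -/

/-- A power network with set of nodes `N` and set of lines `E`; every line is given an (arbitrary)
orientation from `src e` to `tgt e` and a susceptance `β e > 0`. -/
structure PowerNetwork (N E : Type*) where
  src : E → N
  tgt : E → N
  src_ne_tgt : ∀ e, src e ≠ tgt e
  β : E → ℝ
  β_pos : ∀ e, 0 < β e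

namespace PowerNetwork

variable {N E : Type*} [Fintype N] [DecidableEq N] [Fintype E] [DecidableEq E]

/-- The edge-vertex incidence matrix `C` of the network that remains after the lines in `R` have
been removed (removed lines keep a row, which is zero). -/
def incidence (G : PowerNetwork N E) (R : Finset E) : Matrix E N ℝ := fun e i =>
  if e ∈ R then 0 else if i = G.src e then 1 else if i = G.tgt e then -1 else 0

/-- The weighted Laplacian `L = Cᵀ B C` after removal of the lines in `R`. -/
def laplacian (G : PowerNetwork N E) (R : Finset E) : Matrix N N ℝ :=
  (G.incidence R)ᵀ * Matrix.diagonal G.β * G.incidence R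

/-- The PTDF matrix `V = B C L⁺` after removal of the lines in `R`. Since the Laplacian, hence also
its pseudo-inverse, is block diagonal along the islands of the remaining network, the block of an
island is the PTDF matrix of that island. -/
def ptdf (G : PowerNetwork N E) (R : Finset E) : Matrix E N ℝ :=
  Matrix.diagonal G.β * G.incidence R * pseudoInverse (G.laplacian R)

/-- Line flows `f = V (g - d)` for generation `g` and demand `d` after removal of the lines
in `R`. -/
def flow (G : PowerNetwork N E) (R : Finset E) (g d : N → ℝ) : E → ℝ :=
  G.ptdf R *ᵥ (g - d)

/-- The graph on the nodes that is formed by the lines outside `R`. -/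
def remainingGraph (G : PowerNetwork N E) (R : Finset E) : SimpleGraph N :=
  SimpleGraph.fromRel fun i j => ∃ e, e ∉ R ∧ G.src e = i ∧ G.tgt e = j

open Classical in
/-- The island of node `k`: the nodes connected to `k` by lines outside `R`. -/
def island (G : PowerNetwork N E) (R : Finset E) (k : N) : Finset N :=
  Finset.univ.filter fun i => (G.remainingGraph R).Reachable k i

/-! ### Planning and operational stage -/

/-- Operational line limits `λ |V d|`: the fraction `λ` of the absolute line flows in the planning
stage, where generation is the same at all nodes. -/
def operationalLimit (G : PowerNetwork N E) (lam : ℝ) (d : N → ℝ) (e : E) : ℝ :=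
  lam * |(G.ptdf ∅ *ᵥ d) e|

/-- Emergency line limits `F = λ* λ |V d|` with `λ* = 1 / λ`. -/
def emergencyLimit (G : PowerNetwork N E) (lam : ℝ) (d : N → ℝ) (e : E) : ℝ :=
  1 / lam * G.operationalLimit lam d e

/-- Feasible points of the operational DC-OPF with demand `d`. -/
def opfFeasible (G : PowerNetwork N E) (lam : ℝ) (d : N → ℝ) : Set (N → ℝ) :=
  {g | ∑ i, g i = ∑ i, d i ∧ ∀ e, |G.flow ∅ g d e| ≤ G.operationalLimit lam d e}

/-- `g` is a solution of the operational DC-OPF: minimize `∑ g_i² / 2` over the feasible points. -/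
def IsOpfSolution (G : PowerNetwork N E) (lam : ℝ) (d g : N → ℝ) : Prop :=
  g ∈ G.opfFeasible lam d ∧ IsMinOn (fun h : N → ℝ => ∑ i, h i ^ 2 / 2) (G.opfFeasible lam d) g

/-! ### Emergency stage: the cascade -/

/-- Power imbalance (generation minus demand) in the island of node `k`. -/
def imbalance (G : PowerNetwork N E) (R : Finset E) (g d : N → ℝ) (k : N) : ℝ :=
  ∑ i ∈ G.island R k, (g i - d i)

/-- Demand after uniform shedding: in an island with a deficit, all demands are lowered by the same
factor so that total demand becomes total generation. -/
def shedDemand (G : PowerNetwork N E) (R : Finset E) (g d : N → ℝ) (k : N) : ℝ :=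
  if G.imbalance R g d k < 0 then
    (1 + G.imbalance R g d k / ∑ i ∈ G.island R k, d i) * d k
  else d k

/-- Generation after uniform shedding: in an island with a surplus, all generations are lowered by
the same factor so that total generation becomes total demand. -/
def shedGeneration (G : PowerNetwork N E) (R : Finset E) (g d : N → ℝ) (k : N) : ℝ :=
  if G.imbalance R g d k < 0 then g k
  else (1 - G.imbalance R g d k / ∑ i ∈ G.island R k, g i) * g k

/-- The surviving lines whose flow reaches their emergency limit `F`. -/
def overloaded (G : PowerNetwork N E) (F : E → ℝ) (R : Finset E) (g d : N → ℝ) : Set E :=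
  {e | e ∉ R ∧ F e ≤ |G.flow R g d e|}

/-- `G.Cascade F g₀ d₀ l R g d`: starting from generation `g₀`, demand `d₀` and the failure of
line `l`, the cascade can reach the state in which the lines in `R` have failed and generation and
demand have been lowered to `g` and `d`. After each failure power is rebalanced in every island;
the next line to fail is an overloaded line `e` that maximizes `|f e| / F e` among the overloaded
lines (the ratios are compared after multiplying out; any maximizer may be chosen). -/
inductive Cascade (G : PowerNetwork N E) (F : E → ℝ) (g₀ d₀ : N → ℝ) (l : E) :
    Finset E → (N → ℝ) → (N → ℝ) → Prop
  | init : Cascade G F g₀ d₀ l {l} (G.shedGeneration {l} g₀ d₀) (G.shedDemand {l} g₀ d₀)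
  | step {R : Finset E} {g d : N → ℝ} {e : E} (h : Cascade G F g₀ d₀ l R g d)
      (he : e ∈ G.overloaded F R g d)
      (hmax : ∀ e' ∈ G.overloaded F R g d,
        |G.flow R g d e'| * F e ≤ |G.flow R g d e| * F e') :
      Cascade G F g₀ d₀ l (insert e R)
        (G.shedGeneration (insert e R) g d) (G.shedDemand (insert e R) g d)

/-- `s` is the blackout size for city sizes (demands) `x`, loading factor `lam` and first failure
`l`: it is `|∑_{i ∈ A} (x i - g i)|`, where `g` solves the operational DC-OPF and `A` is the island
of a largest city `b` once the cascade has stopped, that is, once no line is overloaded. -/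
def IsBlackoutSize (G : PowerNetwork N E) (lam : ℝ) (x : N → ℝ) (l : E) (s : ℝ) : Prop :=
  ∃ (g : N → ℝ) (R : Finset E) (g' d' : N → ℝ) (b : N),
    G.IsOpfSolution lam x g ∧
    G.Cascade (G.emergencyLimit lam x) g x l R g' d' ∧
    G.overloaded (G.emergencyLimit lam x) R g' d' = ∅ ∧
    (∀ i, x i ≤ x b) ∧
    s = |∑ i ∈ G.island R b, (x i - g i)|

end PowerNetwork

/-! ### The network with six nodes and eight lines -/

/-- The six-node network: two nodes (`Sum.inl`), each joined to all of the four other nodes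
(`Sum.inr`) by a line of susceptance one, and no other lines. -/
def sixNode : PowerNetwork (Fin 2 ⊕ Fin 4) (Fin 2 × Fin 4) where
  src e := Sum.inl e.1
  tgt e := Sum.inr e.2
  src_ne_tgt _ := Sum.inl_ne_inr
  β _ := 1
  β_pos _ := one_pos

/-- The constant `C(λ)` of the six-node network (immaterial at the four endpoints), extended by
zero to `λ < 1/4`. -/
def sixNodePrefactor (α lam : ℝ) : ℝ :=
  if lam < 1 / 4 then 0
  else if lam < 3 / 8 then (lam / 6) ^ α
  else if lam < 1 / 2 then (lam / 6) ^ α + (2 * lam / 3) ^ α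
  else if lam < 3 / 4 then 4 * (lam / 6) ^ α + (2 * lam / 3) ^ α
  else 4 * (lam / 6) ^ α + (lam / 3) ^ α + (2 * lam / 3) ^ α

end

noncomputable section

set_option linter.unusedSectionVars false

/-! ### Flows from potentials, islands and load shedding -/

namespace PowerNetwork

variable {N E : Type*} [Fintype N] [DecidableEq N] [Fintype E] [DecidableEq E]

-- The argument is the principle of a single big jump. Two cities of order `x` occur together with
-- probability `O(x^{-2α})`, so up to this error `S > x` is due to one dominant city `b`, all the
-- others being at most `ε X_b`.
--
-- For dominant `b` the model degenerates. The operational limits at the lines of `b` allow `b` to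
-- import at most the fraction `λ` of its planned import, and convexity makes the generation nearly
-- equal elsewhere: `g_i ≈ (λ/6) X_b` for `i ≠ b` (`abs_opf_sub_le`). Every other node then has a
-- surplus, so the island of `b` is always in deficit and sheds demand, never generation, while the
-- other islands carry negligible power (`Cascade.shedInvariant`). Hence each flow is close to
-- `(λ/6) X_b` times the flow that brings one unit from each other node of the island to `b`, and
-- each emergency limit is close to `|V_{eb}| X_b` (`ShedInvariant.abs_flow_sub_le`,
-- `abs_ptdf_intact_sub_le`).
--
-- Both are rational multiples of `X_b`, up to the factor `λ` in the flows, so the cascade becomes a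
-- finite computation (`settles_lostNodes`). Call the two nodes of degree four hubs and the others
-- leaves. The thresholds are the values of `λ` at which a flow meets its limit: `1/4`: the city is
-- a hub that lost a line to a leaf, whose other line carries one unit against the limit `1/24`;
-- `3/8`: the city is a leaf that lost a line, and each line from another leaf to its remaining hub
-- carries `4/3` units against `2/24`; `1/2`: the city is a leaf, and another leaf lost a line and
-- has its unit on the other one, against `2/24`; `3/4`: the city is a hub, and the other hub has
-- three lines left, each with a third of a unit, against `1/24`. If `n` nodes are cut off from `b`,
-- then `S ≈ n (λ/6) X_b`, and `S = 0` exactly when `n = 0`. Averaging `(nλ/6)^α` over the first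
-- failure and summing over `b` gives `C(λ)` (`tendsto_measureReal_mul_rpow`,
-- `tailConst_lostNodes`).

theorem transpose_laplacian (G : PowerNetwork N E) (R : Finset E) :
    (G.laplacian R)ᵀ = G.laplacian R := by
  simp [laplacian, Matrix.transpose_mul, Matrix.mul_assoc]

/-- The energy `wᵀ L w` is a sum of squares of potential differences with positive weights. -/
theorem incidence_mulVec_eq_zero (G : PowerNetwork N E) (R : Finset E) {w : N → ℝ}
    (hw : G.laplacian R *ᵥ w = 0) : G.incidence R *ᵥ w = 0 := by
  have h : ∑ e, G.β e * (G.incidence R *ᵥ w) e ^ 2 = 0 := by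
    have h1 : w ⬝ᵥ (G.laplacian R *ᵥ w) = 0 := by rw [hw, dotProduct_zero]
    rw [laplacian, ← Matrix.mulVec_mulVec, ← Matrix.mulVec_mulVec, Matrix.dotProduct_mulVec,
      Matrix.vecMul_transpose] at h1
    rw [← h1, dotProduct]
    refine Finset.sum_congr rfl fun e _ => ?_
    rw [Matrix.mulVec_diagonal]
    ring
  funext e
  have := (Finset.sum_eq_zero_iff_of_nonneg fun e _ =>
    mul_nonneg (G.β_pos e).le (sq_nonneg _)).1 h e (Finset.mem_univ e)
  simpa [(G.β_pos e).ne'] using this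

/-- The flow driven by an injection of the form `L θ` is the one given by the potential `θ`. -/
theorem ptdf_mulVec_laplacian (G : PowerNetwork N E) (R : Finset E) (θ : N → ℝ) :
    G.ptdf R *ᵥ (G.laplacian R *ᵥ θ) = Matrix.diagonal G.β *ᵥ (G.incidence R *ᵥ θ) := by
  have hP := isMoorePenrose_pseudoInverse (G.transpose_laplacian R)
  have h0 : G.incidence R *ᵥ (pseudoInverse (G.laplacian R) *ᵥ (G.laplacian R *ᵥ θ) - θ) = 0 := by
    apply G.incidence_mulVec_eq_zero
    rw [Matrix.mulVec_sub, Matrix.mulVec_mulVec, Matrix.mulVec_mulVec,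
      hP.mul_mul_left, sub_self]
  rw [Matrix.mulVec_sub, sub_eq_zero] at h0
  rw [ptdf, ← Matrix.mulVec_mulVec, ← Matrix.mulVec_mulVec, h0]

/-- By the Penrose equations `L⁺ = L⁺ (L⁺)ᵀ L`, so `L⁺` annihilates the kernel of `L`. -/
theorem ptdf_mulVec_eq_zero (G : PowerNetwork N E) (R : Finset E) {w : N → ℝ}
    (hw : G.laplacian R *ᵥ w = 0) : G.ptdf R *ᵥ w = 0 := by
  have hP := isMoorePenrose_pseudoInverse (G.transpose_laplacian R)
  set P := pseudoInverse (G.laplacian R)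
  have h : P *ᵥ w = 0 := by
    have h1 : P = P * (Pᵀ * G.laplacian R) := by
      conv_lhs => rw [← hP.mul_mul_right, Matrix.mul_assoc, ← hP.symm_left, Matrix.transpose_mul,
        G.transpose_laplacian R]
    rw [h1, ← Matrix.mulVec_mulVec, ← Matrix.mulVec_mulVec, hw]
    simp
  rw [ptdf, ← Matrix.mulVec_mulVec, h, Matrix.mulVec_zero]

theorem mem_island {G : PowerNetwork N E} {R : Finset E} {k i : N} :
    i ∈ G.island R k ↔ (G.remainingGraph R).Reachable k i := by
  simp [island]

theorem mem_island_self (G : PowerNetwork N E) (R : Finset E) (k : N) : k ∈ G.island R k :=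
  mem_island.2 (SimpleGraph.Reachable.refl k)

theorem island_eq_of_mem {G : PowerNetwork N E} {R : Finset E} {k i : N}
    (h : i ∈ G.island R k) : G.island R i = G.island R k := by
  ext j
  rw [mem_island] at *
  rw [mem_island]
  exact ⟨fun h' => h.trans h', fun h' => h.symm.trans h'⟩

theorem island_anti (G : PowerNetwork N E) {R R' : Finset E} (h : R ⊆ R') (k : N) :
    G.island R' k ⊆ G.island R k := by
  intro i hi
  rw [mem_island] at *
  refine hi.mono ?_
  intro a b hab
  simp only [remainingGraph, SimpleGraph.fromRel_adj] at *
  refine ⟨hab.1, ?_⟩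
  rcases hab.2 with ⟨e, he, h'⟩ | ⟨e, he, h'⟩
  · exact Or.inl ⟨e, fun h'' => he (h h''), h'⟩
  · exact Or.inr ⟨e, fun h'' => he (h h''), h'⟩

theorem imbalance_eq_of_mem {G : PowerNetwork N E} {R : Finset E} {k i : N}
    (h : i ∈ G.island R k) (g d : N → ℝ) : G.imbalance R g d i = G.imbalance R g d k := by
  rw [imbalance, imbalance, island_eq_of_mem h]

section Shed

variable (G : PowerNetwork N E) (R : Finset E) {g d : N → ℝ}

theorem imbalance_eq_sub (g d : N → ℝ) (k : N) :
    G.imbalance R g d k = ∑ i ∈ G.island R k, g i - ∑ i ∈ G.island R k, d i := by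
  rw [imbalance, Finset.sum_sub_distrib]

theorem shedDemand_mem_Icc (hg : 0 ≤ g) (hd : 0 ≤ d) (k : N) :
    G.shedDemand R g d k ∈ Icc 0 (d k) := by
  rw [shedDemand]
  have hi := G.imbalance_eq_sub R g d k
  have hG : 0 ≤ ∑ i ∈ G.island R k, g i := Finset.sum_nonneg fun i _ => hg i
  split_ifs with h
  · have hD : 0 < ∑ i ∈ G.island R k, d i := by linarith
    have h1 : -1 ≤ G.imbalance R g d k / ∑ i ∈ G.island R k, d i := by
      rw [le_div_iff₀ hD]; linarith
    have h2 : G.imbalance R g d k / ∑ i ∈ G.island R k, d i ≤ 0 :=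
      div_nonpos_of_nonpos_of_nonneg h.le hD.le
    exact ⟨mul_nonneg (by linarith) (hd k), by nlinarith [hd k, mul_nonneg (neg_nonneg.2 h2) (hd k)]⟩
  · exact ⟨hd k, le_rfl⟩

theorem shedGeneration_mem_Icc (hg : 0 ≤ g) (hd : 0 ≤ d) (k : N) :
    G.shedGeneration R g d k ∈ Icc 0 (g k) := by
  rw [shedGeneration]
  have hi := G.imbalance_eq_sub R g d k
  have hD : 0 ≤ ∑ i ∈ G.island R k, d i := Finset.sum_nonneg fun i _ => hd i
  have hG : 0 ≤ ∑ i ∈ G.island R k, g i := Finset.sum_nonneg fun i _ => hg i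
  split_ifs with h
  · exact ⟨hg k, le_rfl⟩
  · have h1 : G.imbalance R g d k / ∑ i ∈ G.island R k, g i ≤ 1 :=
      div_le_one_of_le₀ (by linarith) hG
    have h2 : 0 ≤ G.imbalance R g d k / ∑ i ∈ G.island R k, g i :=
      div_nonneg (not_lt.1 h) hG
    exact ⟨mul_nonneg (by linarith) (hg k), by nlinarith [mul_nonneg h2 (hg k)]⟩

theorem shedGeneration_eq_self {k : N} (h : G.imbalance R g d k ≤ 0) :
    G.shedGeneration R g d k = g k := by
  rw [shedGeneration]
  split_ifs with h'
  · rfl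
  · rw [le_antisymm h (not_lt.1 h')]; simp

theorem sum_shed_eq_zero (hg : 0 ≤ g) (hd : 0 ≤ d) (k : N) :
    ∑ i ∈ G.island R k, (G.shedGeneration R g d i - G.shedDemand R g d i) = 0 := by
  have hi := G.imbalance_eq_sub R g d k
  have hG : 0 ≤ ∑ i ∈ G.island R k, g i := Finset.sum_nonneg fun i _ => hg i
  have hD : 0 ≤ ∑ i ∈ G.island R k, d i := Finset.sum_nonneg fun i _ => hd i
  rw [Finset.sum_sub_distrib]
  by_cases h : G.imbalance R g d k < 0
  · have h1 : ∀ i ∈ G.island R k, G.shedGeneration R g d i = g i := fun i hik => by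
      rw [shedGeneration, imbalance_eq_of_mem hik, if_pos h]
    have h2 : ∀ i ∈ G.island R k, G.shedDemand R g d i =
        (1 + G.imbalance R g d k / ∑ i ∈ G.island R k, d i) * d i := fun i hik => by
      rw [shedDemand, imbalance_eq_of_mem hik, if_pos h, island_eq_of_mem hik]
    rw [Finset.sum_congr rfl h1, Finset.sum_congr rfl h2, ← Finset.mul_sum]
    have : ∑ i ∈ G.island R k, d i ≠ 0 := by linarith
    field_simp
    linarith
  · have h1 : ∀ i ∈ G.island R k, G.shedDemand R g d i = d i := fun i hik => by
      rw [shedDemand, imbalance_eq_of_mem hik, if_neg h]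
    have h2 : ∀ i ∈ G.island R k, G.shedGeneration R g d i =
        (1 - G.imbalance R g d k / ∑ i ∈ G.island R k, g i) * g i := fun i hik => by
      rw [shedGeneration, imbalance_eq_of_mem hik, if_neg h, island_eq_of_mem hik]
    rw [Finset.sum_congr rfl h1, Finset.sum_congr rfl h2, ← Finset.mul_sum]
    rcases hG.eq_or_lt' with h0 | h0
    · rw [h0] at hi ⊢
      simp only [mul_zero]
      linarith
    · field_simp
      linarith

end Shed

end PowerNetwork

/-! ### The cascade under a single dominant demand -/

namespace PowerNetwork

variable {N E : Type*} [Fintype N] [DecidableEq N] [Fintype E] [DecidableEq E]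

/-- What every state of a cascade has in common when all nodes but `b` start with a surplus. -/
structure ShedInvariant (G : PowerNetwork N E) (g₀ x : N → ℝ) (b : N) (R : Finset E)
    (g d : N → ℝ) : Prop where
  demand_nonneg : 0 ≤ d
  demand_le : d ≤ x
  generation_nonneg : 0 ≤ g
  balanced : ∀ k, ∑ i ∈ G.island R k, (g i - d i) = 0
  generation_eq : ∀ i ∈ G.island R b, g i = g₀ i

theorem ShedInvariant.shed {G : PowerNetwork N E} {x g d : N → ℝ} {b : N} {R : Finset E}
    (hg : 0 ≤ g) (hd : 0 ≤ d) (hdx : d ≤ x) {g₀ : N → ℝ} (h₀ : ∀ i ∈ G.island R b, g i = g₀ i)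
    (hb : G.imbalance R g d b ≤ 0) :
    G.ShedInvariant g₀ x b R (G.shedGeneration R g d) (G.shedDemand R g d) where
  demand_nonneg k := (G.shedDemand_mem_Icc R hg hd k).1
  demand_le k := (G.shedDemand_mem_Icc R hg hd k).2.trans (hdx k)
  generation_nonneg k := (G.shedGeneration_mem_Icc R hg hd k).1
  balanced := G.sum_shed_eq_zero R hg hd
  generation_eq i hi := by
    rw [G.shedGeneration_eq_self R (by rwa [imbalance_eq_of_mem hi]), h₀ i hi]

/-- The nodes that split off from a balanced island take a surplus with them, which leaves the
island of `b` in deficit. -/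
theorem imbalance_nonpos_of_subset {G : PowerNetwork N E} {g d : N → ℝ} {b : N} {R : Finset E}
    {I : Finset N} (hI : G.island R b ⊆ I) (h0 : ∑ i ∈ I, (g i - d i) = 0)
    (h : ∀ i ∈ I, i ≠ b → d i ≤ g i) : G.imbalance R g d b ≤ 0 := by
  rw [imbalance, ← h0, ← Finset.sum_sdiff hI]
  have : 0 ≤ ∑ i ∈ I \ G.island R b, (g i - d i) := by
    refine Finset.sum_nonneg fun i hi => ?_
    rw [Finset.mem_sdiff] at hi
    refine sub_nonneg.2 (h i hi.1 ?_)
    rintro rfl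
    exact hi.2 (G.mem_island_self R i)
  linarith

theorem Cascade.shedInvariant {G : PowerNetwork N E} {F : E → ℝ} {g₀ x : N → ℝ} {l : E} {b : N}
    (hg : 0 ≤ g₀) (hx : 0 ≤ x) (hsum : ∑ i, g₀ i = ∑ i, x i) (hxg : ∀ i, i ≠ b → x i ≤ g₀ i)
    {R : Finset E} {g d : N → ℝ} (h : G.Cascade F g₀ x l R g d) :
    G.ShedInvariant g₀ x b R g d := by
  induction h with
  | init =>
    refine ShedInvariant.shed hg hx le_rfl (fun _ _ => rfl)
      (imbalance_nonpos_of_subset (Finset.subset_univ _) ?_ fun i _ => hxg i)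
    rw [Finset.sum_sub_distrib, hsum, sub_self]
  | @step R g d e h he hmax ih =>
    have hsub := G.island_anti (Finset.subset_insert e R) b
    refine ShedInvariant.shed ih.generation_nonneg ih.demand_nonneg ih.demand_le
      (fun i hi => ih.generation_eq i (hsub hi))
      (imbalance_nonpos_of_subset hsub (ih.balanced b) fun i hi hib => ?_)
    rw [ih.generation_eq i hi]
    exact (ih.demand_le i).trans (hxg i hib)

/-- Injection of one unit at every node of the island of `b` other than `b`, taken out at `b`. -/
def unitInjection (G : PowerNetwork N E) (R : Finset E) (b i : N) : ℝ :=
  if i = b then 1 - ((G.island R b).card : ℝ) else if i ∈ G.island R b then 1 else 0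

/-- In the island of `b`, a node other than `b` keeps its generation `≈ u` and has demand at most
`δ`; balance then fixes the injection at `b`. In any other island the total generation equals a
total demand that is at most `card N * δ`, so nothing there is large. -/
theorem ShedInvariant.abs_sub_le {G : PowerNetwork N E} {g₀ x g d : N → ℝ} {b : N} {R : Finset E}
    (h : G.ShedInvariant g₀ x b R g d) {u δ : ℝ} (hδ : 0 ≤ δ) (hx : ∀ i, i ≠ b → x i ≤ δ)
    (hg₀ : ∀ i, i ≠ b → |g₀ i - u| ≤ δ) (i : N) :
    |(g - d) i - u * G.unitInjection R b i| ≤ 2 * Fintype.card N * δ := by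
  have hcard : (1 : ℝ) ≤ Fintype.card N := by
    exact_mod_cast Fintype.card_pos_iff.2 ⟨b⟩
  have hin : ∀ i ∈ G.island R b, i ≠ b → |(g i - d i) - u| ≤ 2 * δ := fun i hi hib => by
    rw [h.generation_eq i hi]
    have h1 := abs_le.1 (hg₀ i hib)
    have h2 := h.demand_nonneg i
    have h3 := (h.demand_le i).trans (hx i hib)
    simp only [Pi.zero_apply] at h2
    rw [abs_le]; constructor <;> linarith
  rw [unitInjection, Pi.sub_apply]
  split_ifs with hib hi
  · subst hib
    have h0 := h.balanced i
    rw [← Finset.add_sum_erase _ _ (G.mem_island_self R i)] at h0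
    have hc : ((G.island R i).card : ℝ) = 1 + ((G.island R i).erase i).card := by
      rw [Finset.card_erase_of_mem (G.mem_island_self R i), Nat.cast_sub, Nat.cast_one]
      · ring
      · exact Finset.card_pos.2 ⟨i, G.mem_island_self R i⟩
    have h1 : (g i - d i) - u * (1 - (G.island R i).card) =
        - ∑ j ∈ (G.island R i).erase i, ((g j - d j) - u) := by
      rw [Finset.sum_sub_distrib (f := fun j => g j - d j), Finset.sum_const, nsmul_eq_mul, hc]
      linarith
    rw [h1, abs_neg]
    refine (Finset.abs_sum_le_sum_abs _ _).trans ?_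
    refine (Finset.sum_le_card_nsmul _ _ (2 * δ) fun j hj => ?_).trans ?_
    · rw [Finset.mem_erase] at hj
      exact hin j hj.2 hj.1
    · rw [nsmul_eq_mul]
      have : (((G.island R i).erase i).card : ℝ) ≤ Fintype.card N := by
        exact_mod_cast Finset.card_le_univ _
      nlinarith
  · rw [mul_one]
    exact (hin i hi hib).trans (by nlinarith)
  · rw [mul_zero, sub_zero]
    have hb : ∀ j ∈ G.island R i, j ≠ b := by
      rintro j hj rfl
      exact hi (by rw [island_eq_of_mem hj]; exact G.mem_island_self R i)
    have hd : ∑ j ∈ G.island R i, d j ≤ Fintype.card N * δ := by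
      refine (Finset.sum_le_card_nsmul _ _ δ fun j hj =>
        (h.demand_le j).trans (hx j (hb j hj))).trans ?_
      rw [nsmul_eq_mul]
      have : ((G.island R i).card : ℝ) ≤ Fintype.card N := by
        exact_mod_cast Finset.card_le_univ _
      nlinarith
    have h0 := h.balanced i
    rw [Finset.sum_sub_distrib] at h0
    have h1 := Finset.single_le_sum (f := g) (fun j _ => h.generation_nonneg j)
      (G.mem_island_self R i)
    have h2 := Finset.single_le_sum (f := d) (fun j _ => h.demand_nonneg j)
      (G.mem_island_self R i)
    have h3 := h.demand_nonneg i
    have h4 := h.generation_nonneg i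
    simp only [Pi.zero_apply] at h3 h4
    rw [abs_le]; constructor <;> nlinarith

/-- A bound for the entries of the rows of all the PTDF matrices. -/
def ptdfBound (G : PowerNetwork N E) : ℝ := ∑ R : Finset E, ∑ e, ∑ i, |G.ptdf R e i|

theorem ptdfBound_nonneg (G : PowerNetwork N E) : 0 ≤ G.ptdfBound := by
  unfold ptdfBound; positivity

theorem abs_ptdf_mulVec_le (G : PowerNetwork N E) (R : Finset E) {p : N → ℝ} {c : ℝ}
    (hp : ∀ i, |p i| ≤ c) (hc : 0 ≤ c) (e : E) : |(G.ptdf R *ᵥ p) e| ≤ G.ptdfBound * c := by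
  have h1 : ∑ i, |G.ptdf R e i| ≤ G.ptdfBound :=
    (Finset.single_le_sum (f := fun e => ∑ i, |G.ptdf R e i|)
      (fun e _ => Finset.sum_nonneg fun i _ => abs_nonneg _) (Finset.mem_univ e)).trans
    (Finset.single_le_sum (f := fun R => ∑ e, ∑ i, |G.ptdf R e i|)
      (fun R _ => Finset.sum_nonneg fun e _ => Finset.sum_nonneg fun i _ => abs_nonneg _)
      (Finset.mem_univ R))
  calc |(G.ptdf R *ᵥ p) e| ≤ ∑ i, |G.ptdf R e i * p i| := Finset.abs_sum_le_sum_abs _ _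
    _ ≤ ∑ i, |G.ptdf R e i| * c := Finset.sum_le_sum fun i _ => by
        rw [abs_mul]; exact mul_le_mul_of_nonneg_left (hp i) (abs_nonneg _)
    _ ≤ G.ptdfBound * c := by
        rw [← Finset.sum_mul]; exact mul_le_mul_of_nonneg_right h1 hc

/-- If the unit injection is driven by the potential `θ`, then the flow in a state of the cascade
is close to the one of the potential `u θ`. -/
theorem ShedInvariant.abs_flow_sub_le {G : PowerNetwork N E} {g₀ x g d : N → ℝ} {b : N}
    {R : Finset E} (h : G.ShedInvariant g₀ x b R g d) {u δ : ℝ} (hδ : 0 ≤ δ)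
    (hx : ∀ i, i ≠ b → x i ≤ δ) (hg₀ : ∀ i, i ≠ b → |g₀ i - u| ≤ δ) {θ : N → ℝ}
    (hθ : G.laplacian R *ᵥ θ = G.unitInjection R b) (e : E) :
    |G.flow R g d e - u * (G.β e * (G.incidence R *ᵥ θ) e)| ≤
      G.ptdfBound * (2 * Fintype.card N * δ) := by
  have h1 := G.abs_ptdf_mulVec_le R (p := (g - d) - u • G.unitInjection R b)
    (fun i => by simpa using h.abs_sub_le hδ hx hg₀ i) (by positivity) e
  rwa [Matrix.mulVec_sub, Matrix.mulVec_smul, ← hθ, ptdf_mulVec_laplacian, Pi.sub_apply,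
    Pi.smul_apply, Matrix.mulVec_diagonal, smul_eq_mul] at h1

theorem island_eq_of_closed {G : PowerNetwork N E} {R : Finset E} {b : N} {D : Finset N}
    (hb : b ∈ D) (hD : ∀ i ∈ D, i ∈ G.island R b)
    (hcl : ∀ e, e ∉ R → (G.src e ∈ D ↔ G.tgt e ∈ D)) : G.island R b = D := by
  refine Finset.Subset.antisymm (fun i hi => ?_) hD
  rw [mem_island] at hi
  obtain ⟨w⟩ := hi
  have : ∀ {a c : N} (_ : (G.remainingGraph R).Walk a c), a ∈ D → c ∈ D := by
    intro a c w
    induction w with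
    | nil => exact id
    | cons hadj _ ih =>
      intro ha
      apply ih
      simp only [remainingGraph, SimpleGraph.fromRel_adj] at hadj
      rcases hadj.2 with ⟨e, he, rfl, rfl⟩ | ⟨e, he, rfl, rfl⟩
      · exact (hcl e he).1 ha
      · exact (hcl e he).2 ha
  exact this w hb

theorem mem_island_of_line {G : PowerNetwork N E} {R : Finset E} {b : N} {e : E} (he : e ∉ R) :
    G.src e ∈ G.island R b ↔ G.tgt e ∈ G.island R b := by
  have hadj : (G.remainingGraph R).Adj (G.src e) (G.tgt e) := by
    simp only [remainingGraph, SimpleGraph.fromRel_adj]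
    exact ⟨G.src_ne_tgt e, Or.inl ⟨e, he, rfl, rfl⟩⟩
  rw [mem_island, mem_island]
  exact ⟨fun h => h.trans hadj.reachable, fun h => h.trans hadj.symm.reachable⟩

end PowerNetwork

/-! ### The intact six-node network -/

namespace SixNode

open PowerNetwork

/-- The entries of the PTDF matrix of the intact network, in units of `1 / 24`. -/
def intactCoeff : Fin 2 ⊕ Fin 4 → Fin 2 × Fin 4 → ℤ
  | Sum.inl a, e => if e.1 = a then 5 else -1
  | Sum.inr v, e => if e.2 = v then -10 else 2

theorem incidence_mulVec (R : Finset (Fin 2 × Fin 4)) (θ : Fin 2 ⊕ Fin 4 → ℝ)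
    (e : Fin 2 × Fin 4) : (sixNode.incidence R *ᵥ θ) e =
      if e ∈ R then 0 else θ (Sum.inl e.1) - θ (Sum.inr e.2) := by
  rw [Matrix.mulVec, dotProduct, Fintype.sum_sum_type]
  by_cases h : e ∈ R
  · simp [incidence, h]
  · simp [incidence, h, sixNode, sub_eq_add_neg]

theorem laplacian_mulVec (R : Finset (Fin 2 × Fin 4)) (θ : Fin 2 ⊕ Fin 4 → ℝ) (i : Fin 2 ⊕ Fin 4) :
    (sixNode.laplacian R *ᵥ θ) i = Sum.elim
      (fun h => ∑ j, (sixNode.incidence R *ᵥ θ) (h, j))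
      (fun j => -∑ h, (sixNode.incidence R *ᵥ θ) (h, j)) i := by
  have hβ : Matrix.diagonal sixNode.β = (1 : Matrix (Fin 2 × Fin 4) (Fin 2 × Fin 4) ℝ) := by
    simp [sixNode]
  rw [laplacian, hβ, Matrix.mul_one, ← Matrix.mulVec_mulVec, Matrix.mulVec_transpose,
    Matrix.vecMul, dotProduct, Fintype.sum_prod_type]
  have key : ∀ e, (sixNode.incidence R *ᵥ θ) e * sixNode.incidence R e i =
      (sixNode.incidence R *ᵥ θ) e *
        Sum.elim (fun h => if h = e.1 then (1 : ℝ) else 0) (fun j => if j = e.2 then -1 else 0) i := by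
    intro e
    by_cases h : e ∈ R
    · rw [incidence_mulVec, if_pos h]; simp
    · congr 1
      rcases i with i | i <;> simp [incidence, h, sixNode]
  simp only [key]
  rcases i with i | i
  · simp
  · rw [Finset.sum_comm]
    simp

theorem sum_abs_intactCoeff_le (e : Fin 2 × Fin 4) : ∑ i, |intactCoeff i e| ≤ 24 := by
  revert e; decide

theorem sum_intactCoeff_mul (x : Fin 2 ⊕ Fin 4 → ℝ) (e : Fin 2 × Fin 4) :
    ∑ i, intactCoeff i e * x i = 6 * x (Sum.inl e.1) - ∑ a, x (Sum.inl a) -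
      12 * x (Sum.inr e.2) + 2 * ∑ v, x (Sum.inr v) := by
  have h1 : ∀ a, (intactCoeff (Sum.inl a) e : ℝ) * x (Sum.inl a) =
      6 * (if e.1 = a then x (Sum.inl a) else 0) - x (Sum.inl a) := fun a => by
    simp only [intactCoeff]; split_ifs <;> push_cast <;> ring
  have h2 : ∀ v, (intactCoeff (Sum.inr v) e : ℝ) * x (Sum.inr v) =
      2 * x (Sum.inr v) - 12 * (if e.2 = v then x (Sum.inr v) else 0) := fun v => by
    simp only [intactCoeff]; split_ifs <;> push_cast <;> ring
  rw [Fintype.sum_sum_type]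
  simp only [h1, h2, Finset.sum_sub_distrib, ← Finset.mul_sum, Finset.sum_ite_eq, Finset.mem_univ,
    if_true]
  ring

/-- The constant part of `x` lies in the kernel of the Laplacian; the rest is driven by the explicit
potential `θ`. -/
theorem ptdf_intact_mulVec (x : Fin 2 ⊕ Fin 4 → ℝ) (e : Fin 2 × Fin 4) :
    (sixNode.ptdf ∅ *ᵥ x) e = (∑ i, intactCoeff i e * x i) / 24 := by
  set m : ℝ := (∑ i, x i) / 6 with hm
  set θ : Fin 2 ⊕ Fin 4 → ℝ := Sum.elim (fun h => (x (Sum.inl h) - m) / 4)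
    (fun j => (x (Sum.inr j) - m) / 2 + (x (Sum.inl 0) + x (Sum.inl 1) - 2 * m) / 8) with hθ
  have h1 : sixNode.laplacian ∅ *ᵥ (fun _ => m) = 0 := by
    funext i
    rw [laplacian_mulVec]
    rcases i with i | i <;> simp [incidence_mulVec]
  have h2 : x = sixNode.laplacian ∅ *ᵥ θ + fun _ => m := by
    simp only [Fintype.sum_sum_type, Fin.sum_univ_two, Fin.sum_univ_four] at hm
    funext i
    rw [Pi.add_apply, laplacian_mulVec]
    rcases i with i | i
    · simp only [incidence_mulVec, hθ, Finset.notMem_empty, if_false, Sum.elim_inl, Sum.elim_inr,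
        Fin.sum_univ_four]
      linarith
    · simp only [incidence_mulVec, hθ, Finset.notMem_empty, if_false, Sum.elim_inl, Sum.elim_inr,
        Fin.sum_univ_two]
      linarith
  have h3 : (sixNode.ptdf ∅ *ᵥ x) e = θ (Sum.inl e.1) - θ (Sum.inr e.2) := by
    conv_lhs => rw [h2]
    rw [Matrix.mulVec_add, ptdf_mulVec_eq_zero _ _ h1, ptdf_mulVec_laplacian, add_zero,
      Matrix.mulVec_diagonal, incidence_mulVec]
    simp [sixNode]
  rw [h3, sum_intactCoeff_mul]
  simp only [Fintype.sum_sum_type, Fin.sum_univ_two, Fin.sum_univ_four, hθ,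
    Sum.elim_inl, Sum.elim_inr] at hm ⊢
  linarith

theorem abs_ptdf_intact_sub_le {x : Fin 2 ⊕ Fin 4 → ℝ} {b : Fin 2 ⊕ Fin 4} {δ : ℝ} (hx : 0 ≤ x)
    (hδ : 0 ≤ δ) (hb : ∀ i, i ≠ b → x i ≤ δ) (e : Fin 2 × Fin 4) :
    |(sixNode.ptdf ∅ *ᵥ x) e - intactCoeff b e / 24 * x b| ≤ δ := by
  have h0 : (sixNode.ptdf ∅ *ᵥ x) e - intactCoeff b e / 24 * x b =
      (∑ i ∈ Finset.univ.erase b, intactCoeff i e * x i) / 24 := by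
    rw [ptdf_intact_mulVec, ← Finset.add_sum_erase _ _ (Finset.mem_univ b)]
    ring
  have h1 : ∑ i ∈ Finset.univ.erase b, |(intactCoeff i e : ℝ)| ≤ 24 := by
    refine (Finset.sum_le_sum_of_subset_of_nonneg (Finset.erase_subset _ _)
      fun i _ _ => abs_nonneg _).trans ?_
    exact_mod_cast sum_abs_intactCoeff_le e
  rw [h0, abs_div, abs_of_pos (by norm_num : (0 : ℝ) < 24), div_le_iff₀ (by norm_num)]
  calc |∑ i ∈ Finset.univ.erase b, intactCoeff i e * x i|
      ≤ ∑ i ∈ Finset.univ.erase b, |(intactCoeff i e : ℝ) * x i| := Finset.abs_sum_le_sum_abs _ _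
    _ ≤ ∑ i ∈ Finset.univ.erase b, |(intactCoeff i e : ℝ)| * δ := by
        refine Finset.sum_le_sum fun i hi => ?_
        rw [abs_mul, abs_of_nonneg (hx i)]
        exact mul_le_mul_of_nonneg_left (hb i (Finset.ne_of_mem_erase hi)) (abs_nonneg _)
    _ ≤ δ * 24 := by
        rw [← Finset.sum_mul]; nlinarith

theorem sum_ptdf_inl {p : Fin 2 ⊕ Fin 4 → ℝ} (hp : ∑ i, p i = 0) (a : Fin 2) :
    ∑ j, (sixNode.ptdf ∅ *ᵥ p) (a, j) = p (Sum.inl a) := by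
  simp only [ptdf_intact_mulVec, sum_intactCoeff_mul]
  simp only [Fintype.sum_sum_type, Fin.sum_univ_two, Fin.sum_univ_four] at hp ⊢
  linarith

theorem sum_ptdf_inr {p : Fin 2 ⊕ Fin 4 → ℝ} (hp : ∑ i, p i = 0) (v : Fin 4) :
    ∑ h, (sixNode.ptdf ∅ *ᵥ p) (h, v) = -p (Sum.inr v) := by
  simp only [ptdf_intact_mulVec, sum_intactCoeff_mul]
  simp only [Fintype.sum_sum_type, Fin.sum_univ_two, Fin.sum_univ_four] at hp ⊢
  linarith

/-! ### The operational optimum for a dominant city -/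

section Opf

variable {lam : ℝ} {x g : Fin 2 ⊕ Fin 4 → ℝ} {b : Fin 2 ⊕ Fin 4} {δ : ℝ}

theorem ptdf_mulVec_sub_mean (x : Fin 2 ⊕ Fin 4 → ℝ) :
    sixNode.ptdf ∅ *ᵥ (fun i => x i - (∑ j, x j) / 6) = sixNode.ptdf ∅ *ᵥ x := by
  funext e
  simp only [ptdf_intact_mulVec, mul_sub, Finset.sum_sub_distrib, ← Finset.sum_mul]
  have : ∑ i, (intactCoeff i e : ℝ) = 0 := by
    have h : ∑ i, intactCoeff i e = 0 := by revert e; decide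
    exact_mod_cast h
  rw [this, zero_mul, sub_zero]

/-- The lines at `b` carry at most the fraction `lam` of their planned flow, so the net demand
of `b` is at most the fraction `lam` of the planned one. -/
theorem le_generation_of_feasible (hx : 0 ≤ x) (hδ : 0 ≤ δ)
    (hb : ∀ i, i ≠ b → x i ≤ δ) (hδx : 5 * δ ≤ x b) (hg : g ∈ sixNode.opfFeasible lam x) :
    (1 - lam) * x b + lam * ((∑ i, x i) / 6) ≤ g b := by
  obtain ⟨hsum, hf⟩ := hg
  have hp : ∑ i, (g - x) i = 0 := by simp [Finset.sum_sub_distrib, hsum]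
  have hp' : ∑ i, (fun i => x i - (∑ j, x j) / 6) i = 0 := by
    rw [Finset.sum_sub_distrib]; simp; ring
  have hV := abs_ptdf_intact_sub_le hx hδ hb
  unfold operationalLimit flow at hf
  rcases b with a | v
  · have h1 := sum_ptdf_inl hp a
    have h2 := sum_ptdf_inl hp' a
    rw [ptdf_mulVec_sub_mean] at h2
    have h3 : ∑ j, -(lam * (sixNode.ptdf ∅ *ᵥ x) (a, j)) ≤
        ∑ j, (sixNode.ptdf ∅ *ᵥ (g - x)) (a, j) := by
      refine Finset.sum_le_sum fun j _ => ?_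
      have h4 := (abs_le.1 (hf (a, j))).1
      have h5 := (abs_le.1 (hV (a, j))).1
      rw [abs_of_nonneg] at h4
      · exact h4
      -- `5 * δ ≤ x b` makes the contribution of `b`, at least `5/24 * x b` in size, outweigh the
      -- error `δ`. So the planned flows on the lines of `b` have a common sign and their absolute
      -- values add up to the planned import.
      · simp only [intactCoeff, if_true] at h5
        push_cast at h5
        linarith
    rw [Finset.sum_neg_distrib, ← Finset.mul_sum, h1, h2, Pi.sub_apply] at h3
    linarith
  · have h1 := sum_ptdf_inr hp v
    have h2 := sum_ptdf_inr hp' v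
    rw [ptdf_mulVec_sub_mean] at h2
    have h3 : ∑ h, (sixNode.ptdf ∅ *ᵥ (g - x)) (h, v) ≤
        ∑ h, -(lam * (sixNode.ptdf ∅ *ᵥ x) (h, v)) := by
      refine Finset.sum_le_sum fun j _ => ?_
      have h4 := (abs_le.1 (hf (j, v))).2
      have h5 := (abs_le.1 (hV (j, v))).2
      rw [abs_of_nonpos] at h4
      · linarith
      · simp only [intactCoeff, if_true] at h5
        push_cast at h5
        linarith
    rw [Finset.sum_neg_distrib, ← Finset.mul_sum, h1, h2, Pi.sub_apply] at h3
    linarith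

/-- Moving demand a fraction `lam` of the way towards its mean gives exactly `-lam` times the
planned flows. All limits are tight, and at `b` the lower bound of `le_generation_of_feasible` is
attained. -/
theorem scaled_mem_opfFeasible (hlam : 0 < lam) (x : Fin 2 ⊕ Fin 4 → ℝ) :
    (fun i => (1 - lam) * x i + lam * ((∑ j, x j) / 6)) ∈ sixNode.opfFeasible lam x := by
  refine ⟨?_, fun e => le_of_eq ?_⟩
  · rw [Finset.sum_add_distrib, ← Finset.mul_sum]
    simp
    ring
  · have : (fun i => (1 - lam) * x i + lam * ((∑ j, x j) / 6)) - x =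
        (-lam) • fun i => x i - (∑ j, x j) / 6 := by
      funext i; simp; ring
    rw [operationalLimit, flow, this, Matrix.mulVec_smul, ptdf_mulVec_sub_mean, Pi.smul_apply,
      smul_eq_mul, abs_mul, abs_neg, abs_of_pos hlam]

theorem self_mem_opfFeasible (hlam : 0 < lam) (x : Fin 2 ⊕ Fin 4 → ℝ) :
    x ∈ sixNode.opfFeasible lam x :=
  ⟨rfl, fun e => by
    rw [flow, sub_self, Matrix.mulVec_zero, operationalLimit]; simp; positivity⟩

theorem sum_sq_le_of_isOpfSolution (hg : sixNode.IsOpfSolution lam x g) {h : Fin 2 ⊕ Fin 4 → ℝ}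
    (hh : h ∈ sixNode.opfFeasible lam x) : ∑ i, g i ^ 2 ≤ ∑ i, h i ^ 2 := by
  have := hg.2 hh
  simp only [mem_ofPred_eq, ← Finset.sum_div] at this
  linarith

/-- Comparison with the scaled demand `hh`. The totals agree, so optimality gives a smaller sum of
squared deviations from any constant `w`. For `w` the mean of `hh` off `b`, the term at `b` is at
least as large for `g`, since `w ≤ hh b ≤ g b`; the deviations off `b` are therefore no larger than
those of `hh`. -/
theorem abs_opf_sub_le (hlam : lam ∈ Ioo (0 : ℝ) 1) (hx : 0 ≤ x) (hδ : 0 ≤ δ)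
    (hb : ∀ i, i ≠ b → x i ≤ δ) (hδx : 5 * δ ≤ x b) (hg : sixNode.IsOpfSolution lam x g)
    {i : Fin 2 ⊕ Fin 4} (hi : i ≠ b) : |g i - lam / 6 * x b| ≤ 4 * δ := by
  have hcut := le_generation_of_feasible hx hδ hb hδx hg.1
  have hsq := sum_sq_le_of_isOpfSolution hg (scaled_mem_opfFeasible hlam.1 x)
  have hsum := hg.1.1
  set T := ∑ i, x i with hT
  set hh : Fin 2 ⊕ Fin 4 → ℝ := fun i => (1 - lam) * x i + lam * (T / 6) with hhd
  have hhsum : ∑ i, hh i = T := (scaled_mem_opfFeasible hlam.1 x).1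
  set s := Finset.univ.erase b with hs
  have hcard : (s.card : ℝ) = 5 := by
    rw [hs, Finset.card_erase_of_mem (Finset.mem_univ b)]; simp
  have split : ∀ f : Fin 2 ⊕ Fin 4 → ℝ, ∑ i, f i = f b + ∑ i ∈ s, f i := fun f =>
    (Finset.add_sum_erase _ _ (Finset.mem_univ b)).symm
  rw [split] at hsq hsum hhsum
  rw [split (fun i => hh i ^ 2)] at hsq
  have hxs := split x
  rw [← hT] at hxs
  set r := ∑ i ∈ s, x i with hr
  have hr0 : 0 ≤ r := Finset.sum_nonneg fun i _ => hx i
  have hr5 : r ≤ 5 * δ := by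
    rw [← hcard, ← nsmul_eq_mul]
    exact Finset.sum_le_card_nsmul _ _ _ fun i hi => hb i (Finset.ne_of_mem_erase hi)
  set w := (T - hh b) / 5 with hw
  have hdev : ∀ f : Fin 2 ⊕ Fin 4 → ℝ, ∑ i ∈ s, (f i - w) ^ 2 =
      ∑ i ∈ s, f i ^ 2 - 2 * w * ∑ i ∈ s, f i + 5 * w ^ 2 := by
    intro f
    have : ∀ i, (f i - w) ^ 2 = f i ^ 2 - 2 * w * f i + w ^ 2 := fun i => by ring
    simp only [this, Finset.sum_add_distrib, Finset.sum_sub_distrib, ← Finset.mul_sum,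
      Finset.sum_const, nsmul_eq_mul, hcard]
  have hwe : w = lam / 6 * x b + (1 - lam / 6) * (r / 5) := by
    simp only [hw, hhd, hxs]; ring
  have hwr : ∀ i, hh i - w = (1 - lam) * (x i - r / 5) := fun i => by
    rw [hwe]; simp only [hhd, hxs]; ring
  have hh_dev : ∑ i ∈ s, (hh i - w) ^ 2 ≤ 5 * δ ^ 2 := by
    rw [← hcard, ← nsmul_eq_mul]
    refine Finset.sum_le_card_nsmul _ _ _ fun i hi => ?_
    rw [hwr]
    have h1 := hb i (Finset.ne_of_mem_erase hi)
    have h2 := hx i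
    simp only [Pi.zero_apply] at h2
    apply sq_le_sq'
    · nlinarith [hlam.1, hlam.2]
    · nlinarith [hlam.1, hlam.2]
  have hbw : w ≤ hh b := by
    have := hwr b
    nlinarith [hlam.1, hlam.2]
  have hg_dev : ∑ i ∈ s, (g i - w) ^ 2 ≤ 5 * δ ^ 2 := by
    refine le_trans ?_ hh_dev
    have e1 : ∑ i ∈ s, g i = T - g b := by linarith
    have e2 : ∑ i ∈ s, hh i = T - hh b := by linarith
    have e3 : T - hh b = 5 * w := by rw [hw]; ring
    have e4 : T = 5 * w + hh b := by linarith
    rw [hdev, hdev, e1, e2, e4]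
    have h5 : 0 ≤ (g b - hh b) * (hh b + g b - 2 * w) :=
      mul_nonneg (sub_nonneg.2 hcut) (by have := hcut; simp only [hhd] at this hbw ⊢; linarith)
    nlinarith
  have h1 := (Finset.single_le_sum (f := fun i => (g i - w) ^ 2) (fun i _ => sq_nonneg _)
    (Finset.mem_erase.2 ⟨hi, Finset.mem_univ i⟩)).trans hg_dev
  -- A single deviation is at most `√5 * δ`.
  have h2 : |g i - w| ≤ 3 * δ := by
    refine abs_le_of_sq_le_sq ?_ (by linarith)
    nlinarith [sq_nonneg δ]
  have h3 : |w - lam / 6 * x b| ≤ δ := by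
    rw [hwe, add_sub_cancel_left, abs_of_nonneg] <;> nlinarith [hlam.1, hlam.2]
  calc |g i - lam / 6 * x b| = |(g i - w) + (w - lam / 6 * x b)| := by ring_nf
    _ ≤ 4 * δ := (abs_add_le _ _).trans (by linarith)

end Opf

end SixNode

/-! ### The limiting cascade as a finite computation -/

namespace SixNode

/-- The hub other than `a`. -/
def otherHub (a : Fin 2) : Fin 2 := 1 - a

/-- The number of leaves other than those in `b` whose two lines have both survived. -/
def throughLeaves (b : Fin 2 ⊕ Fin 4) (R : List (Fin 2 × Fin 4)) : ℕ :=
  (List.finRange 4).countP fun j => decide (b ≠ Sum.inr j) && !R.contains (0, j) && !R.contains (1, j)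

/-- A potential for the unit injection towards `b`, in units of `1 / 12`, in those networks that
arise in the cascades that are triggered by a large demand at `b`. -/
def potential (b : Fin 2 ⊕ Fin 4) (R : List (Fin 2 × Fin 4)) : Fin 2 ⊕ Fin 4 → ℤ :=
  let c : ℤ := throughLeaves b R
  match b with
  | Sum.inl a =>
    if R.length = 1 ∧ ∃ j, R.contains (a, j) then
      Sum.elim (fun h => if h = a then 0 else 28) (fun j => if R.contains (a, j) then 40 else 20)
    else
      Sum.elim (fun h => if h = a then 0 else if c = 0 then 0 else 12 + 24 / c)
        (fun j => if R.contains (a, j) then 0 else if R.contains (otherHub a, j) then 12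
          else 12 + 12 / c)
  | Sum.inr v =>
    if ∃ h, R.contains (h, v) then
      if c = 0 then Sum.elim (fun h => if R.contains (h, v) then 0 else 12) (fun _ => 0)
      else
        Sum.elim (fun h => if R.contains (h, v) then 48 + 96 / c else 60) (fun j => if j = v then 0
          else if R.contains (0, j) || R.contains (1, j) then 60 + 96 / c else 60 + 48 / c)
    else if R.length = 1 then
      Sum.elim (fun h => if ∃ j, R.contains (h, j) then 28 else 32) (fun j => if j = v then 0
        else if R.contains (0, j) || R.contains (1, j) then 44 else 36)
    else
      Sum.elim (fun _ => 24) (fun j => if j = v then 0 else if R.contains (0, j) then 0 else 30)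

/-- The flow of the potential, in units of `1 / 12`. -/
def unitFlow (b : Fin 2 ⊕ Fin 4) (R : List (Fin 2 × Fin 4)) (e : Fin 2 × Fin 4) : ℤ :=
  if R.contains e then 0 else potential b R (Sum.inl e.1) - potential b R (Sum.inr e.2)

/-- The island of `b` in the networks that arise in the cascades that are triggered by a large
demand at `b`. -/
def inIsland (b : Fin 2 ⊕ Fin 4) (R : List (Fin 2 × Fin 4)) : Fin 2 ⊕ Fin 4 → Bool :=
  if throughLeaves b R = 0 then
    match b with
    | Sum.inl a => Sum.elim (fun h => h == a) (fun j => !R.contains (a, j))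
    | Sum.inr v => Sum.elim (fun h => !R.contains (h, v)) (fun j => j == v)
  else Sum.elim (fun _ => true) (fun j => !R.contains (0, j) || !R.contains (1, j))

/-- The number of nodes in `D`. -/
def size (D : Fin 2 ⊕ Fin 4 → Bool) : ℕ :=
  (List.finRange 2).countP (fun h => D (Sum.inl h)) + (List.finRange 4).countP fun j => D (Sum.inr j)

/-- The unit injection in an island `D`. -/
def injection (b : Fin 2 ⊕ Fin 4) (D : Fin 2 ⊕ Fin 4 → Bool) (i : Fin 2 ⊕ Fin 4) : ℤ :=
  if i = b then 1 - size D else if D i then 1 else 0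

/-- The set `D` is the island of `b`, and the potential drives the unit injection. -/
def IsConsistent (b : Fin 2 ⊕ Fin 4) (R : List (Fin 2 × Fin 4)) (D : Fin 2 ⊕ Fin 4 → Bool) :
    Prop :=
  D b ∧ (∀ h j, R.contains (h, j) ∨ D (Sum.inl h) = D (Sum.inr j)) ∧
  (∀ h, unitFlow b R (h, 0) + unitFlow b R (h, 1) + unitFlow b R (h, 2) + unitFlow b R (h, 3) =
    12 * injection b D (Sum.inl h)) ∧
  (∀ j, unitFlow b R (0, j) + unitFlow b R (1, j) = -(12 * injection b D (Sum.inr j))) ∧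
  (∀ h j, (unitFlow b R (h, j)).natAbs ≤ 60)

instance (b : Fin 2 ⊕ Fin 4) (R : List (Fin 2 × Fin 4)) (D : Fin 2 ⊕ Fin 4 → Bool) :
    Decidable (IsConsistent b R D) := by
  unfold IsConsistent; infer_instance

/-- For every loading factor between `lo / 8` and `hi / 8`, every cascade that has reached the
failure of the lines in `R` stops when `n` nodes are cut off from `b`, after at most `k` more
failures. -/
def Settles (lo hi : ℕ) (b : Fin 2 ⊕ Fin 4) (n : ℕ) : ℕ → List (Fin 2 × Fin 4) → Prop
  | 0, _ => False
  | k + 1, R => IsConsistent b R (inIsland b R) ∧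
    ((size (inIsland b R) + n = 6 ∧
        ∀ h j, R.contains (h, j) ∨
          (unitFlow b R (h, j)).natAbs * hi ≤ 24 * (intactCoeff b (h, j)).natAbs) ∨
      ((∃ h j, ¬ R.contains (h, j) ∧
          24 * (intactCoeff b (h, j)).natAbs ≤ (unitFlow b R (h, j)).natAbs * lo) ∧
        ∀ h j, R.contains (h, j) ∨
          (∃ h' j', ¬ R.contains (h', j') ∧
            24 * (intactCoeff b (h', j')).natAbs ≤ (unitFlow b R (h', j')).natAbs * lo ∧
            (unitFlow b R (h, j)).natAbs * (intactCoeff b (h', j')).natAbs <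
              (unitFlow b R (h', j')).natAbs * (intactCoeff b (h, j)).natAbs) ∨
          Settles lo hi b n k ((h, j) :: R)))

instance decidableSettles (lo hi : ℕ) (b : Fin 2 ⊕ Fin 4) (n : ℕ) :
    ∀ k R, Decidable (Settles lo hi b n k R)
  | 0, _ => inferInstanceAs (Decidable False)
  | k + 1, R =>
    haveI := decidableSettles lo hi b n k
    by unfold Settles; infer_instance

/-- The number of nodes that are cut off from the dominant city `b` at the end of the cascade
after the failure of the line `l`, for a loading factor in the `k`-th interval. -/
def lostNodes (k : Fin 5) : Fin 2 ⊕ Fin 4 → Fin 2 × Fin 4 → ℕ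
  | Sum.inl a, l => if l.1 = a then (if k = 0 then 0 else if k = 4 then 2 else 1)
      else if k = 4 then 1 else 0
  | Sum.inr v, l => if l.2 = v then (if k ≤ 1 then 0 else 4) else if k ≤ 2 then 0 else 1

/-- The endpoints of the intervals of loading factors, in units of `1 / 8`. -/
def endpoint : Fin 6 → ℕ := ![0, 2, 3, 4, 6, 8]

/-- With `q` the flow in units of `1/12` and `r` the coefficient in units of `1/24`, flow against
limit is `lam * q / 72` against `r / 24`, that is, `lam * q` against `3 * r`; this explains the
tests `q * hi ≤ 24 * r` and `24 * r ≤ q * lo`. `Settles` follows every line that is not strictly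
beaten by a surely overloaded one, which covers all ways to break ties. The depth `5` leaves room
for four further failures. They occur when a hub `a` is dominant, a line at `a` fails and `lam >
3/4`: the leaf is cut off, then the three remaining lines of the other hub fail. -/
theorem settles_lostNodes : ∀ (k : Fin 5) (b : Fin 2 ⊕ Fin 4) (l : Fin 2 × Fin 4),
    Settles (endpoint k.castSucc) (endpoint k.succ) b (lostNodes k b l) 5 [l] := by
  decide +kernel
end SixNode

/-! ### From the finite computation to real flows -/

namespace SixNode

open PowerNetwork

theorem size_eq_card (D : Fin 2 ⊕ Fin 4 → Bool) :
    size D = (Finset.univ.filter fun i => D i = true).card := by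
  rw [Finset.card_filter, Fintype.sum_sum_type, Fin.sum_univ_two, Fin.sum_univ_four]
  simp only [size, List.finRange_succ, List.finRange_zero, List.map_cons, List.map_nil,
    List.countP_cons, List.countP_nil]
  simp [Fin.succ_zero_eq_one]
  omega

theorem incidence_mulVec_potential (b : Fin 2 ⊕ Fin 4) (R : List (Fin 2 × Fin 4))
    (e : Fin 2 × Fin 4) :
    (sixNode.incidence R.toFinset *ᵥ fun i => (potential b R i : ℝ) / 12) e =
      unitFlow b R e / 12 := by
  rw [incidence_mulVec, unitFlow]
  simp only [List.mem_toFinset, List.contains_iff_mem]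
  split_ifs <;> push_cast <;> ring

theorem laplacian_mulVec_potential {b : Fin 2 ⊕ Fin 4} {R : List (Fin 2 × Fin 4)}
    {D : Fin 2 ⊕ Fin 4 → Bool} (h : IsConsistent b R D) (i : Fin 2 ⊕ Fin 4) :
    (sixNode.laplacian R.toFinset *ᵥ fun i => (potential b R i : ℝ) / 12) i = injection b D i := by
  rw [laplacian_mulVec]
  rcases i with i | i
  · have := h.2.2.1 i
    simp only [Sum.elim_inl, incidence_mulVec_potential, Fin.sum_univ_four]
    have h' : ((unitFlow b R (i, 0) + unitFlow b R (i, 1) + unitFlow b R (i, 2) +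
      unitFlow b R (i, 3) : ℤ) : ℝ) = (12 * injection b D (Sum.inl i) : ℤ) := by rw [this]
    push_cast at h'
    linarith
  · have := h.2.2.2.1 i
    simp only [Sum.elim_inr, incidence_mulVec_potential, Fin.sum_univ_two]
    have h' : ((unitFlow b R (0, i) + unitFlow b R (1, i) : ℤ) : ℝ) =
      (-(12 * injection b D (Sum.inr i)) : ℤ) := by rw [this]
    push_cast at h'
    linarith

theorem laplacian_mulVec_indicator {R : Finset (Fin 2 × Fin 4)} {J : Finset (Fin 2 ⊕ Fin 4)}
    (hJ : ∀ e, e ∉ R → (Sum.inl e.1 ∈ J ↔ Sum.inr e.2 ∈ J)) :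
    sixNode.laplacian R *ᵥ (fun i => if i ∈ J then (1 : ℝ) else 0) = 0 := by
  have h : sixNode.incidence R *ᵥ (fun i => if i ∈ J then (1 : ℝ) else 0) = 0 := by
    funext e
    rw [incidence_mulVec]
    by_cases he : e ∈ R
    · simp [he]
    · simp [he, hJ e he]
  funext i
  rw [laplacian_mulVec, h]
  rcases i with i | i <;> simp

/-- No set of nodes without a line to the other nodes has a net injection. -/
theorem sum_laplacian_mulVec_eq_zero {R : Finset (Fin 2 × Fin 4)} {J : Finset (Fin 2 ⊕ Fin 4)}
    (hJ : ∀ e, e ∉ R → (Sum.inl e.1 ∈ J ↔ Sum.inr e.2 ∈ J)) (θ : Fin 2 ⊕ Fin 4 → ℝ) :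
    ∑ i ∈ J, (sixNode.laplacian R *ᵥ θ) i = 0 := by
  have h : (fun i => if i ∈ J then (1 : ℝ) else 0) ⬝ᵥ (sixNode.laplacian R *ᵥ θ) = 0 := by
    rw [Matrix.dotProduct_mulVec, ← Matrix.mulVec_transpose, transpose_laplacian,
      laplacian_mulVec_indicator hJ, zero_dotProduct]
  simpa [dotProduct, Finset.sum_ite_mem] using h

/-- The potential certifies connectedness. `D` is closed under surviving lines; if it had nodes
outside the island of `b`, these would form a closed set with injection one at every node, whereas a
Laplacian image sums to zero over closed sets. -/
theorem island_eq_of_isConsistent {b : Fin 2 ⊕ Fin 4} {R : List (Fin 2 × Fin 4)}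
    {D : Fin 2 ⊕ Fin 4 → Bool} (h : IsConsistent b R D) :
    sixNode.island R.toFinset b = Finset.univ.filter fun i => D i = true := by
  set I := sixNode.island R.toFinset b with hI
  have hD : ∀ e, e ∉ R.toFinset → (D (Sum.inl e.1) = D (Sum.inr e.2)) := fun e he => by
    rcases h.2.1 e.1 e.2 with h' | h'
    · exact absurd (by simpa using h') he
    · exact h'
  have hcl : ∀ e, e ∉ R.toFinset → (Sum.inl e.1 ∈ I ↔ Sum.inr e.2 ∈ I) := fun e he =>
    mem_island_of_line (G := sixNode) he
  have hJ := sum_laplacian_mulVec_eq_zero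
    (R := R.toFinset) (J := Finset.univ.filter fun i => D i = true ∧ i ∉ I)
    (fun e he => by simp [hD e he, hcl e he]) (fun i => (potential b R i : ℝ) / 12)
  refine island_eq_of_closed (by simpa using h.1) (fun i hi => ?_) fun e he => by
    have := hD e he
    simpa [sixNode] using by rw [this]
  by_contra hiI
  have h1 : ∀ j ∈ Finset.univ.filter (fun i => D i = true ∧ i ∉ I),
      (sixNode.laplacian R.toFinset *ᵥ fun i => (potential b R i : ℝ) / 12) j = 1 := by
    intro j hj
    rw [Finset.mem_filter] at hj
    rw [laplacian_mulVec_potential h, injection, if_neg, if_pos hj.2.1, Int.cast_one]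
    rintro rfl
    exact hj.2.2 (mem_island_self _ _ _)
  rw [Finset.sum_congr rfl h1] at hJ
  simp only [Finset.sum_const, nsmul_eq_mul, mul_one, Nat.cast_eq_zero, Finset.card_eq_zero] at hJ
  have : i ∈ Finset.univ.filter (fun i => D i = true ∧ i ∉ I) := by
    simpa using ⟨(Finset.mem_filter.1 hi).2, hiI⟩
  rw [hJ] at this
  simp at this

theorem laplacian_mulVec_eq_unitInjection {b : Fin 2 ⊕ Fin 4} {R : List (Fin 2 × Fin 4)}
    {D : Fin 2 ⊕ Fin 4 → Bool} (h : IsConsistent b R D) :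
    sixNode.laplacian R.toFinset *ᵥ (fun i => (potential b R i : ℝ) / 12) =
      sixNode.unitInjection R.toFinset b := by
  funext i
  rw [laplacian_mulVec_potential h, unitInjection, injection, island_eq_of_isConsistent h,
    size_eq_card]
  simp only [Finset.mem_filter_univ]
  split_ifs <;> simp

theorem emergencyLimit_eq {lam : ℝ} (hlam : 0 < lam) (x : Fin 2 ⊕ Fin 4 → ℝ)
    (e : Fin 2 × Fin 4) : sixNode.emergencyLimit lam x e = |(sixNode.ptdf ∅ *ᵥ x) e| := by
  rw [emergencyLimit, operationalLimit]
  field_simp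

section Comparison

variable {lam γ η X f F f' F' : ℝ} {q r q' r' lo hi : ℕ}

/-- For `q ≥ 1` the distance `γ` of `lam` from the endpoint yields a margin of at least `γ / 72`,
which exceeds the two errors `η`; for `q = 0` the margin is at least `1 / 24`. -/
theorem flow_lt_limit (hX : 0 < X) (hγ0 : 0 < γ) (hγ : γ ≤ 1) (hη : 144 * η < γ) (hr : 1 ≤ r)
    (hf : |f - lam / 72 * q * X| ≤ η * X) (hF : |F - r / 24 * X| ≤ η * X)
    (hhi : lam + γ ≤ hi / 8) (h : q * hi ≤ 24 * r) : f < F := by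
  have h1 := (abs_le.1 hf).2
  have h2 := (abs_le.1 hF).1
  have h' : (q : ℝ) * hi ≤ 24 * r := by exact_mod_cast h
  have hr' : (1 : ℝ) ≤ r := by exact_mod_cast hr
  have key : 2 * η < r / 24 - lam / 72 * q := by
    rcases Nat.eq_zero_or_pos q with rfl | hq
    · push_cast; linarith
    · have hq' : (1 : ℝ) ≤ q := by exact_mod_cast hq
      nlinarith
  nlinarith

theorem limit_le_flow (hX : 0 < X) (hγ : 0 < γ) (hη : 144 * η < γ) (hr : 1 ≤ r)
    (hf : |f - lam / 72 * q * X| ≤ η * X) (hF : |F - r / 24 * X| ≤ η * X)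
    (hlo : lo / 8 + γ ≤ lam) (h : 24 * r ≤ q * lo) : F ≤ f := by
  have h1 := (abs_le.1 hf).1
  have h2 := (abs_le.1 hF).2
  have h' : 24 * (r : ℝ) ≤ q * lo := by exact_mod_cast h
  have hr' : (1 : ℝ) ≤ r := by exact_mod_cast hr
  have hq : (1 : ℝ) ≤ q := by
    rcases Nat.eq_zero_or_pos q with rfl | hq
    · omega
    · exact_mod_cast hq
  have key : 2 * η < lam / 72 * q - r / 24 := by nlinarith
  nlinarith

/-- For integers `q * r' < q' * r` means a gap of at least one, hence `lam / 1728` after scaling.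
The terms in `η ^ 2` cancel and the linear ones add up to at most `5 / 2 * η`, which is smaller. -/
theorem flow_mul_limit_lt (hX : 0 < X) (hlam : lam ∈ Ioo (0 : ℝ) 1) (hη : 5000 * η < lam)
    (hη0 : 0 ≤ η) (hr : 1 ≤ r) (hr2 : r ≤ 10) (hr2' : r' ≤ 10) (hq : q ≤ 60) (hq' : q' ≤ 60)
    (hf : |f - lam / 72 * q * X| ≤ η * X) (hF : |F - r / 24 * X| ≤ η * X)
    (hf' : |f' - lam / 72 * q' * X| ≤ η * X) (hF' : |F' - r' / 24 * X| ≤ η * X)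
    (hF0 : 0 ≤ F') (h : q * r' < q' * r) : f * F' < f' * F := by
  have h' : (q : ℝ) * r' + 1 ≤ q' * r := by exact_mod_cast h
  have e1 : (1 : ℝ) ≤ r := by exact_mod_cast hr
  have e2 : (r : ℝ) ≤ 10 := by exact_mod_cast hr2
  have e3 : (r' : ℝ) ≤ 10 := by exact_mod_cast hr2'
  have e4 : (q : ℝ) ≤ 60 := by exact_mod_cast hq
  have e5 : (q' : ℝ) ≤ 60 := by exact_mod_cast hq'
  have e6 : (1 : ℝ) ≤ q' := by
    rcases Nat.eq_zero_or_pos q' with rfl | hq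
    · omega
    · exact_mod_cast hq
  have a1 : f ≤ (lam / 72 * q + η) * X := by linarith [(abs_le.1 hf).2]
  have a2 : F' ≤ (r' / 24 + η) * X := by linarith [(abs_le.1 hF').2]
  have a3 : (lam / 72 * q' - η) * X ≤ f' := by linarith [(abs_le.1 hf').1]
  have a4 : (r / 24 - η) * X ≤ F := by linarith [(abs_le.1 hF).1]
  have hl0 := hlam.1
  have hl1 := hlam.2
  have b1 : 0 ≤ lam / 72 * q' - η := by nlinarith
  have b2 : 0 ≤ r / 24 - η := by linarith
  have b3 : 0 ≤ lam / 72 * q + η := by positivity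
  have c1 : f * F' ≤ ((lam / 72 * q + η) * X) * ((r' / 24 + η) * X) :=
    mul_le_mul a1 a2 hF0 (by positivity)
  have c2 : ((lam / 72 * q' - η) * X) * ((r / 24 - η) * X) ≤ f' * F :=
    mul_le_mul a3 a4 (by positivity) (le_trans (by positivity) a3)
  have c3 : (lam / 72 * q + η) * (r' / 24 + η) < (lam / 72 * q' - η) * (r / 24 - η) := by
    have d1 : lam / 72 * q ≤ 60 / 72 := by nlinarith [(Nat.cast_nonneg q : (0 : ℝ) ≤ q)]
    have d2 : lam / 72 * q' ≤ 60 / 72 := by nlinarith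
    have d3 : η * (lam / 72 * q + lam / 72 * q' + r / 24 + r' / 24) ≤ η * (5 / 2) :=
      mul_le_mul_of_nonneg_left (by linarith) hη0
    have d4 : lam / 1728 * (q * r' + 1) ≤ lam / 1728 * (q' * r) :=
      mul_le_mul_of_nonneg_left h' (by positivity)
    linarith
  have hX2 : 0 < X * X := mul_pos hX hX
  nlinarith [mul_lt_mul_of_pos_right c3 hX2]

end Comparison

theorem abs_abs_sub_le {a c X t : ℝ} (hX : 0 ≤ X) (h : |a - c * X| ≤ t) : |(|a| - |c| * X)| ≤ t := by
  have := abs_abs_sub_abs_le a (c * X)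
  rw [abs_mul, abs_of_nonneg hX] at this
  exact this.trans h

end SixNode

/-! ### The blackout size for a dominant city -/

namespace SixNode

open PowerNetwork

section Dominant

variable {lam γ ε : ℝ} {lo hi n : ℕ} {x g₀ : Fin 2 ⊕ Fin 4 → ℝ} {b : Fin 2 ⊕ Fin 4}
  {l : Fin 2 × Fin 4}

/-- The city `b` is dominant in the demand `x`, and `g₀` is a corresponding initial generation;
the loading factor `lam` is away from the endpoints `lo / 8` and `hi / 8`. -/
structure IsDominant (lam γ ε : ℝ) (lo hi : ℕ) (x g₀ : Fin 2 ⊕ Fin 4 → ℝ) (b : Fin 2 ⊕ Fin 4) :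
    Prop where
  lam_mem : lam ∈ Ioo (0 : ℝ) 1
  gap_pos : 0 < γ
  gap_le : γ ≤ 1
  lo_le : lo / 8 + γ ≤ lam
  le_hi : lam + γ ≤ hi / 8
  eps_nonneg : 0 ≤ ε
  -- `(48 * ptdfBound + 40) * ε` is a common relative error for flows and limits. Here `48 = 2 * 6 *
  -- 4`, from six nodes and the error `4 * ε` of the generation; `40` is slack that covers the
  -- limits and keeps `ε` itself small. The factor `5000` is the one in `flow_mul_limit_lt`.
  eps_le : 5000 * (48 * sixNode.ptdfBound + 40) * ε < γ
  demand_nonneg : 0 ≤ x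
  demand_pos : 0 < x b
  demand_le : ∀ i, i ≠ b → x i ≤ ε * x b
  isOpfSolution : sixNode.IsOpfSolution lam x g₀

namespace IsDominant

theorem gap_le_lam (h : IsDominant lam γ ε lo hi x g₀ b) : γ ≤ lam := by
  have := h.lo_le
  have h2 : (0 : ℝ) ≤ lo / 8 := by positivity
  linarith

theorem eps_lt (h : IsDominant lam γ ε lo hi x g₀ b) : 200000 * ε < γ := by
  have h1 := h.eps_le
  have h2 : 0 ≤ sixNode.ptdfBound * ε := mul_nonneg sixNode.ptdfBound_nonneg h.eps_nonneg
  linarith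

theorem abs_generation_sub_le (h : IsDominant lam γ ε lo hi x g₀ b) {i : Fin 2 ⊕ Fin 4}
    (hi : i ≠ b) : |g₀ i - lam / 6 * x b| ≤ 4 * (ε * x b) := by
  refine abs_opf_sub_le h.lam_mem h.demand_nonneg (mul_nonneg h.eps_nonneg h.demand_pos.le)
    h.demand_le ?_ h.isOpfSolution hi
  have := h.eps_lt
  have := h.gap_le
  nlinarith [h.demand_pos]

theorem demand_le_generation (h : IsDominant lam γ ε lo hi x g₀ b) {i : Fin 2 ⊕ Fin 4}
    (hi : i ≠ b) : x i ≤ g₀ i := by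
  have h1 := (abs_le.1 (h.abs_generation_sub_le hi)).1
  have h2 := h.demand_le i hi
  have h3 := h.eps_lt
  have h4 := h.gap_le_lam
  have h5 : 5 * ε ≤ lam / 6 := by linarith [h.eps_nonneg]
  nlinarith [mul_le_mul_of_nonneg_right h5 h.demand_pos.le]

theorem generation_nonneg (h : IsDominant lam γ ε lo hi x g₀ b) : 0 ≤ g₀ := by
  intro i
  by_cases hib : i = b
  · subst hib
    have hx := h.demand_nonneg
    refine le_trans ?_ (le_generation_of_feasible hx
      (mul_nonneg h.eps_nonneg h.demand_pos.le) h.demand_le ?_ h.isOpfSolution.1)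
    · have h1 : 0 ≤ ∑ j, x j := Finset.sum_nonneg fun j _ => hx j
      have h2 := h.lam_mem.1
      have h3 := h.lam_mem.2
      have h4 : 0 ≤ (1 - lam) * x i := mul_nonneg (by linarith) h.demand_pos.le
      simp only [Pi.zero_apply]
      positivity
    · have := h.eps_lt
      have := h.gap_le
      nlinarith [h.demand_pos]
  · exact (h.demand_nonneg i).trans (h.demand_le_generation hib)

theorem shedInvariant (h : IsDominant lam γ ε lo hi x g₀ b) {F : Fin 2 × Fin 4 → ℝ}
    {R : Finset (Fin 2 × Fin 4)} {g d : Fin 2 ⊕ Fin 4 → ℝ}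
    (hc : sixNode.Cascade F g₀ x l R g d) : sixNode.ShedInvariant g₀ x b R g d :=
  hc.shedInvariant h.generation_nonneg h.demand_nonneg h.isOpfSolution.1.1
    fun _ hi => h.demand_le_generation hi

theorem abs_flow_sub_le (h : IsDominant lam γ ε lo hi x g₀ b) {F : Fin 2 × Fin 4 → ℝ}
    {R : List (Fin 2 × Fin 4)} {g d : Fin 2 ⊕ Fin 4 → ℝ}
    (hc : sixNode.Cascade F g₀ x l R.toFinset g d) {D : Fin 2 ⊕ Fin 4 → Bool}
    (hR : IsConsistent b R D) (e : Fin 2 × Fin 4) :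
    |(|sixNode.flow R.toFinset g d e| - lam / 72 * (unitFlow b R e).natAbs * x b)| ≤
      (48 * sixNode.ptdfBound + 40) * ε * x b := by
  have hεx : 0 ≤ ε * x b := mul_nonneg h.eps_nonneg h.demand_pos.le
  have h1 := (h.shedInvariant hc).abs_flow_sub_le (u := lam / 6 * x b) (δ := 4 * (ε * x b))
    (by positivity) (fun i hi => (h.demand_le i hi).trans (by linarith))
    (fun i hi => h.abs_generation_sub_le hi) (laplacian_mulVec_eq_unitInjection hR) e
  rw [incidence_mulVec_potential] at h1
  have h2 := abs_abs_sub_le (c := lam / 72 * (unitFlow b R e)) h.demand_pos.le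
    (a := sixNode.flow R.toFinset g d e) (t := (48 * sixNode.ptdfBound + 40) * ε * x b) (by
      refine le_trans (le_of_eq ?_) (h1.trans ?_)
      · congr 1
        simp only [sixNode]
        ring
      · simp only [Fintype.card_sum, Fintype.card_fin]
        push_cast
        linarith)
  rwa [abs_mul, abs_of_pos (by linarith [h.lam_mem.1] : (0 : ℝ) < lam / 72), ← Int.cast_abs,
    ← Nat.cast_natAbs] at h2

theorem abs_limit_sub_le (h : IsDominant lam γ ε lo hi x g₀ b) (e : Fin 2 × Fin 4) :
    |sixNode.emergencyLimit lam x e - ((intactCoeff b e).natAbs : ℝ) / 24 * x b| ≤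
      (48 * sixNode.ptdfBound + 40) * ε * x b := by
  have hεx : 0 ≤ ε * x b := mul_nonneg h.eps_nonneg h.demand_pos.le
  rw [emergencyLimit_eq h.lam_mem.1]
  have h1 := abs_abs_sub_le h.demand_pos.le
    (abs_ptdf_intact_sub_le h.demand_nonneg hεx h.demand_le e)
  rw [abs_div, abs_of_pos (by norm_num : (0 : ℝ) < 24), ← Int.cast_abs,
    ← Nat.cast_natAbs] at h1
  refine h1.trans ?_
  have := mul_nonneg sixNode.ptdfBound_nonneg hεx
  linarith

theorem natAbs_intactCoeff (b : Fin 2 ⊕ Fin 4) (e : Fin 2 × Fin 4) :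
    1 ≤ (intactCoeff b e).natAbs ∧ (intactCoeff b e).natAbs ≤ 10 := by
  rcases b with a | v <;> simp only [intactCoeff] <;> split_ifs <;> decide

/-- Every failure after the first one is among those that `Settles` takes into account. -/
theorem exists_settles (h : IsDominant lam γ ε lo hi x g₀ b) (hl : ∃ k, Settles lo hi b n k [l])
    {R : Finset (Fin 2 × Fin 4)} {g d : Fin 2 ⊕ Fin 4 → ℝ}
    (hc : sixNode.Cascade (sixNode.emergencyLimit lam x) g₀ x l R g d) :
    ∃ k R', R'.toFinset = R ∧ Settles lo hi b n k R' := by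
  have hη : 144 * ((48 * sixNode.ptdfBound + 40) * ε) < γ := by
    have h1 := h.eps_le
    have h2 : 0 ≤ (48 * sixNode.ptdfBound + 40) * ε :=
      mul_nonneg (by linarith [sixNode.ptdfBound_nonneg]) h.eps_nonneg
    linarith
  have hη' : 5000 * ((48 * sixNode.ptdfBound + 40) * ε) < lam := by
    linarith [h.eps_le, h.gap_le_lam]
  induction hc with
  | init => obtain ⟨k, hk⟩ := hl; exact ⟨k, [l], by simp, hk⟩
  | @step R g d e hc he hmax ih =>
    obtain ⟨k, R', rfl, hk⟩ := ih
    cases k with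
    | zero => exact hk.elim
    | succ k =>
      obtain ⟨hR, hfin | ⟨-, hgo⟩⟩ := hk
      · exfalso
        rcases hfin.2 e.1 e.2 with h' | h'
        · exact he.1 (by simpa using h')
        · exact absurd he.2 (not_le.2 (flow_lt_limit h.demand_pos h.gap_pos h.gap_le hη
            (natAbs_intactCoeff b e).1 (h.abs_flow_sub_le hc hR e) (h.abs_limit_sub_le e)
            h.le_hi h'))
      -- The failing line has survived so far, and by maximality it is not strictly beaten by an
      -- overloaded line; so it is one of those that `Settles` follows.
      · rcases hgo e.1 e.2 with h' | ⟨h', j', hj, hover, hlt⟩ | h'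
        · exact absurd (by simpa using h') he.1
        · exfalso
          have hmem : (h', j') ∈ sixNode.overloaded (sixNode.emergencyLimit lam x)
              R'.toFinset g d :=
            ⟨by simpa using hj, limit_le_flow h.demand_pos h.gap_pos hη
              (natAbs_intactCoeff b (h', j')).1 (h.abs_flow_sub_le hc hR _)
              (h.abs_limit_sub_le _) h.lo_le hover⟩
          refine absurd (hmax _ hmem) (not_le.2 (flow_mul_limit_lt h.demand_pos h.lam_mem hη' ?_
            (natAbs_intactCoeff b e).1 (natAbs_intactCoeff b e).2 (natAbs_intactCoeff b _).2
            (hR.2.2.2.2 _ _) (hR.2.2.2.2 _ _) (h.abs_flow_sub_le hc hR e) (h.abs_limit_sub_le e)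
            (h.abs_flow_sub_le hc hR _) (h.abs_limit_sub_le _) ?_ hlt))
          · exact mul_nonneg (by linarith [sixNode.ptdfBound_nonneg]) h.eps_nonneg
          · rw [emergencyLimit_eq h.lam_mem.1]; exact abs_nonneg _
        · exact ⟨k, e :: R', by simp, h'⟩

/-- The final state satisfies `Settles`. The branch that continues provides a line that is surely
overloaded, so only the terminal branch, which fixes the size of the island, is compatible with
`hend`. -/
theorem card_island (h : IsDominant lam γ ε lo hi x g₀ b) (hl : ∃ k, Settles lo hi b n k [l])
    {R : Finset (Fin 2 × Fin 4)} {g d : Fin 2 ⊕ Fin 4 → ℝ}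
    (hc : sixNode.Cascade (sixNode.emergencyLimit lam x) g₀ x l R g d)
    (hend : sixNode.overloaded (sixNode.emergencyLimit lam x) R g d = ∅) :
    (sixNode.island R b).card + n = 6 := by
  have hη : 144 * ((48 * sixNode.ptdfBound + 40) * ε) < γ := by
    have h1 := h.eps_le
    have h2 : 0 ≤ (48 * sixNode.ptdfBound + 40) * ε :=
      mul_nonneg (by linarith [sixNode.ptdfBound_nonneg]) h.eps_nonneg
    linarith
  obtain ⟨k, R', rfl, hk⟩ := h.exists_settles hl hc
  cases k with
  | zero => exact hk.elim
  | succ k =>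
    obtain ⟨hR, hfin | ⟨⟨h', j', hj, hover⟩, -⟩⟩ := hk
    · rw [island_eq_of_isConsistent hR, ← size_eq_card]
      exact hfin.1
    · exfalso
      have hmem : (h', j') ∈ sixNode.overloaded (sixNode.emergencyLimit lam x) R'.toFinset g d :=
        ⟨by simpa using hj, limit_le_flow h.demand_pos h.gap_pos hη
          (natAbs_intactCoeff b (h', j')).1 (h.abs_flow_sub_le hc hR _)
          (h.abs_limit_sub_le _) h.lo_le hover⟩
      rw [hend] at hmem
      exact hmem

/-- Total generation equals total demand, so the shortfall in the island is the surplus of the `n`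
lost nodes, each `lam / 6 * x b` up to `5 * ε * x b`. -/
theorem abs_sum_island_sub_le (h : IsDominant lam γ ε lo hi x g₀ b)
    {R : Finset (Fin 2 × Fin 4)} (hR : (sixNode.island R b).card + n = 6) :
    |(|∑ i ∈ sixNode.island R b, (x i - g₀ i)| - n * lam / 6 * x b)| ≤ 30 * ε * x b := by
  have hsum : ∑ i, (g₀ i - x i) = 0 := by
    rw [Finset.sum_sub_distrib, h.isOpfSolution.1.1, sub_self]
  have h1 : ∑ i ∈ sixNode.island R b, (x i - g₀ i) =
      ∑ i ∈ (sixNode.island R b)ᶜ, (g₀ i - x i) := by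
    rw [← Finset.sum_add_sum_compl (sixNode.island R b)] at hsum
    have : ∑ i ∈ sixNode.island R b, (x i - g₀ i) = -∑ i ∈ sixNode.island R b, (g₀ i - x i) := by
      rw [← Finset.sum_neg_distrib]; simp
    linarith
  have hcard : ((sixNode.island R b)ᶜ).card = n := by
    rw [Finset.card_compl]; simp; omega
  have h2 : ∑ i ∈ (sixNode.island R b)ᶜ, (g₀ i - x i) - n * lam / 6 * x b =
      ∑ i ∈ (sixNode.island R b)ᶜ, (g₀ i - x i - lam / 6 * x b) := by
    rw [Finset.sum_sub_distrib (f := fun i => g₀ i - x i), Finset.sum_const, hcard, nsmul_eq_mul]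
    ring
  have h3 : |∑ i ∈ (sixNode.island R b)ᶜ, (g₀ i - x i - lam / 6 * x b)| ≤ 30 * ε * x b := by
    refine (Finset.abs_sum_le_sum_abs _ _).trans
      ((Finset.sum_le_card_nsmul _ _ (5 * (ε * x b)) fun i hi => ?_).trans ?_)
    · have hib : i ≠ b := by
        rintro rfl
        exact Finset.mem_compl.1 hi (mem_island_self _ _ _)
      have h4 := abs_le.1 (h.abs_generation_sub_le hib)
      have h5 := h.demand_le i hib
      have h6 := h.demand_nonneg i
      simp only [Pi.zero_apply] at h6
      rw [abs_le]; constructor <;> linarith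
    · rw [hcard, nsmul_eq_mul]
      have : (n : ℝ) ≤ 6 := by exact_mod_cast (by omega : n ≤ 6)
      have hεx : 0 ≤ ε * x b := mul_nonneg h.eps_nonneg h.demand_pos.le
      nlinarith
  have hnn : 0 ≤ n * lam / 6 := by have := h.lam_mem.1; positivity
  rw [h1, ← abs_of_nonneg hnn]
  exact abs_abs_sub_le h.demand_pos.le (by rw [h2]; exact h3)

end IsDominant

end Dominant

/-- The blackout size when one city is much larger than the others. -/
theorem exists_abs_blackout_sub_le (k : Fin 5) {lam : ℝ}
    (hlo : (endpoint k.castSucc : ℝ) / 8 < lam) (hhi : lam < (endpoint k.succ : ℝ) / 8) :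
    ∃ ε₀ > 0, ∀ ε ∈ Ioc 0 ε₀, ∀ (x : Fin 2 ⊕ Fin 4 → ℝ) (b : Fin 2 ⊕ Fin 4), 0 ≤ x → 0 < x b →
      (∀ i, i ≠ b → x i ≤ ε * x b) → ∀ l s, sixNode.IsBlackoutSize lam x l s →
        |s - lostNodes k b l * lam / 6 * x b| ≤ 30 * ε * x b ∧ (lostNodes k b l = 0 → s = 0) := by
  have hM := sixNode.ptdfBound_nonneg
  have hlo0 : (0 : ℝ) ≤ (endpoint k.castSucc : ℝ) / 8 := by positivity
  have hhi1 : (endpoint k.succ : ℝ) / 8 ≤ 1 := by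
    rw [div_le_one (by norm_num)]
    have : ∀ k : Fin 5, endpoint k.succ ≤ 8 := by decide
    exact_mod_cast this k
  set γ := min (lam - (endpoint k.castSucc : ℝ) / 8) ((endpoint k.succ : ℝ) / 8 - lam) with hγ
  have hγ0 : 0 < γ := lt_min (by linarith) (by linarith)
  have hγ1 := min_le_left (lam - (endpoint k.castSucc : ℝ) / 8) ((endpoint k.succ : ℝ) / 8 - lam)
  have hγ2 := min_le_right (lam - (endpoint k.castSucc : ℝ) / 8) ((endpoint k.succ : ℝ) / 8 - lam)
  rw [← hγ] at hγ1 hγ2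
  set A := 5000 * (48 * sixNode.ptdfBound + 40) with hA
  have hA0 : 0 < A := by positivity
  refine ⟨γ / (2 * A), by positivity, fun ε hε x b hx hxb hdom l s hs => ?_⟩
  obtain ⟨g, R, g', d', c, hg, hc, hend, hmax, rfl⟩ := hs
  have hεA : A * ε < γ := by
    have := hε.2
    rw [le_div_iff₀ (by positivity)] at this
    linarith
  have hdomi : IsDominant lam γ ε (endpoint k.castSucc) (endpoint k.succ) x g b :=
    ⟨⟨by linarith, by linarith⟩, hγ0, by linarith, by linarith, by linarith, hε.1.le, hεA, hx,
      hxb, hdom, hg⟩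
  have hcb : c = b := by
    by_contra hne
    have h1 := (hmax b).trans (hdom c hne)
    have h2 := hdomi.eps_lt
    have h3 := hdomi.gap_le
    nlinarith
  subst hcb
  have hcard := hdomi.card_island ⟨5, settles_lostNodes k c l⟩ hc hend
  refine ⟨hdomi.abs_sum_island_sub_le hcard, fun h0 => ?_⟩
  have huniv : sixNode.island R c = Finset.univ := by
    rw [← Finset.card_eq_iff_eq_univ]
    simp
    omega
  rw [huniv, Finset.sum_sub_distrib, hg.1.1, sub_self, abs_zero]

/-- The blackout size is at most a multiple of the size of the largest city. -/
theorem blackout_le {lam : ℝ} (hlam : 0 < lam) {x : Fin 2 ⊕ Fin 4 → ℝ} {b : Fin 2 ⊕ Fin 4}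
    (hx : 0 ≤ x) (hb : ∀ i, x i ≤ x b) {l : Fin 2 × Fin 4} {s : ℝ}
    (hs : sixNode.IsBlackoutSize lam x l s) : s ≤ 24 * x b := by
  obtain ⟨g, R, g', d', c, hg, -, -, -, rfl⟩ := hs
  have hsq := sum_sq_le_of_isOpfSolution hg (self_mem_opfFeasible hlam x)
  have h1 : ∑ i, x i ^ 2 ≤ 6 * x b ^ 2 := by
    refine (Finset.sum_le_card_nsmul _ _ (x b ^ 2) fun i _ => pow_le_pow_left₀ (hx i) (hb i) 2).trans
      (le_of_eq ?_)
    simp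
  -- The demand itself is feasible, so `∑ g_i² ≤ 6 (x b)²`, and `√6 < 3`.
  have hg3 : ∀ i, |g i| ≤ 3 * x b := fun i => by
    have h2 := Finset.single_le_sum (f := fun i => g i ^ 2) (fun i _ => sq_nonneg _)
      (Finset.mem_univ i)
    refine abs_le_of_sq_le_sq ?_ (by have := hx b; simp only [Pi.zero_apply] at this; linarith)
    nlinarith [sq_nonneg (x b)]
  refine (Finset.abs_sum_le_sum_abs _ _).trans
    ((Finset.sum_le_sum_of_subset_of_nonneg (Finset.subset_univ _) fun i _ _ => abs_nonneg _).trans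
      ((Finset.sum_le_card_nsmul _ _ (4 * x b) fun i _ => ?_).trans (le_of_eq ?_)))
  · have h2 := abs_le.1 (hg3 i)
    have h3 := hb i
    have h4 := hx i
    simp only [Pi.zero_apply] at h4
    rw [abs_le]; constructor <;> linarith
  · simp
    ring

end SixNode

/-! ### Regularly varying tails and bounds for a single big jump -/

namespace RegularTail

section Real

variable {K α a a' : ℝ} {T T' : ℝ → ℝ}

theorem tendsto_mul_rpow (hK : 0 < K) (hT : T ~[atTop] fun x => K * x ^ (-α)) (ha : 0 < a) :
    Tendsto (fun x => T (x / a) * x ^ α) atTop (𝓝 (K * a ^ α)) := by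
  have h1 : Tendsto (fun x => T x * x ^ α) atTop (𝓝 K) := by
    have hne : ∀ᶠ x : ℝ in atTop, K * x ^ (-α) ≠ 0 := by
      filter_upwards [eventually_gt_atTop 0] with x hx
      positivity
    have h := ((isEquivalent_iff_tendsto_one hne).1 hT).const_mul K
    rw [mul_one] at h
    refine h.congr' ?_
    filter_upwards [eventually_gt_atTop 0] with x hx
    have := Real.rpow_pos_of_pos hx α
    rw [Pi.div_apply, Real.rpow_neg hx.le]
    field_simp
  have h2 := (h1.comp (tendsto_id.atTop_div_const ha)).mul_const (a ^ α)
  refine h2.congr' ?_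
  filter_upwards [eventually_gt_atTop 0] with x hx
  simp only [Function.comp, id]
  rw [mul_assoc, ← Real.mul_rpow (by positivity) ha.le, div_mul_cancel₀ _ ha.ne']

theorem isBigO_rpow (hK : 0 < K) (hT : T ~[atTop] fun x => K * x ^ (-α)) (ha : 0 < a) :
    (fun x => T (x / a)) =O[atTop] fun x => x ^ (-α) := by
  have h1 := ((tendsto_mul_rpow hK hT ha).isBigO_one ℝ).mul (isBigO_refl (fun x : ℝ => x ^ (-α)) atTop)
  refine (h1.congr' ?_ ?_)
  · filter_upwards [eventually_gt_atTop 0] with x hx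
    rw [mul_assoc, ← Real.rpow_add hx]
    simp
  · filter_upwards with x
    rw [one_mul]

theorem isBigO_mul (hK : 0 < K) (hT : T ~[atTop] fun x => K * x ^ (-α))
    (hT' : T' ~[atTop] fun x => K * x ^ (-α)) (ha : 0 < a) (ha' : 0 < a') :
    (fun x => T (x / a) * T' (x / a')) =O[atTop] fun x => x ^ (-(2 * α)) := by
  refine ((isBigO_rpow hK hT ha).mul (isBigO_rpow hK hT' ha')).congr' (EventuallyEq.refl _ _) ?_
  filter_upwards [eventually_gt_atTop 0] with x hx
  rw [← Real.rpow_add hx]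
  congr 1
  ring

theorem tendsto_mul_rpow_zero_of_isBigO (hα : 0 < α) {f : ℝ → ℝ}
    (hf : f =O[atTop] fun x => x ^ (-(2 * α))) :
    Tendsto (fun x => f x * x ^ α) atTop (𝓝 0) := by
  have h := hf.mul (isBigO_refl (fun x : ℝ => x ^ α) atTop)
  refine (h.trans_eventuallyEq ?_).trans_tendsto (tendsto_rpow_neg_atTop hα)
  filter_upwards [eventually_gt_atTop 0] with x hx
  rw [← Real.rpow_add hx]
  congr 1
  ring

end Real

section BigJump

variable {Ω ι κ : Type*} [MeasurableSpace Ω] {μ : Measure Ω} [IsProbabilityMeasure μ]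
  [Fintype ι] [DecidableEq ι] [Nonempty ι] [Fintype κ] [DecidableEq κ] [MeasurableSpace κ]
  [MeasurableSingletonClass κ]
  {X : ι → Ω → ℝ} {ℓ : Ω → κ} {S : Ω → ℝ} {c : ι → κ → ℝ} {B D ε p : ℝ}

/-- The random variable `S` is a function of the largest of the `X i` up to a small error if all
the others are much smaller. -/
structure IsSingleJump (X : ι → Ω → ℝ) (ℓ : Ω → κ) (S : Ω → ℝ) (c : ι → κ → ℝ) (B D ε : ℝ)
    (ω : Ω) : Prop where
  nonneg : ∀ i, 0 ≤ X i ω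
  le : ∀ b, (∀ i, X i ω ≤ X b ω) → S ω ≤ B * X b ω
  abs_sub_le : ∀ b, 0 < X b ω → (∀ i, i ≠ b → X i ω ≤ ε * X b ω) →
    |S ω - c b (ℓ ω) * X b ω| ≤ D * ε * X b ω ∧ (c b (ℓ ω) = 0 → S ω = 0)

theorem measureReal_inter_eq_mul {i j : ι} (hXindep : iIndepFun X μ) (hij : i ≠ j) (s t : ℝ) :
    μ.real ({ω | s < X i ω} ∩ {ω | t < X j ω}) =
      μ.real {ω | s < X i ω} * μ.real {ω | t < X j ω} := by
  have h := (hXindep.indepFun hij).measure_inter_preimage_eq_mul (Ioi s) (Ioi t)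
    measurableSet_Ioi measurableSet_Ioi
  rw [measureReal_def, measureReal_def, measureReal_def, ← ENNReal.toReal_mul]
  exact congrArg _ h

theorem measureReal_eq_inter (hℓindep : IndepFun (fun ω i => X i ω) ℓ μ) (e : κ) (i : ι) (s : ℝ) :
    μ.real ({ω | ℓ ω = e} ∩ {ω | s < X i ω}) = μ.real {ω | ℓ ω = e} * μ.real {ω | s < X i ω} := by
  have h := (hℓindep.symm.comp measurable_id (measurable_pi_apply i)).measure_inter_preimage_eq_mul
    {e} (Ioi s) (measurableSet_singleton e) measurableSet_Ioi
  rw [measureReal_def, measureReal_def, measureReal_def, ← ENNReal.toReal_mul]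
  exact congrArg _ h

/-- The union bound for the probability that two of the variables are large. -/
def pairTail (μ : Measure Ω) (X : ι → Ω → ℝ) (a a' x : ℝ) : ℝ :=
  ∑ b, ∑ i, if i = b then 0 else μ.real {ω | x / a < X b ω} * μ.real {ω | x / a' < X i ω}

theorem isBigO_pairTail {K α a a' : ℝ} (hK : 0 < K)
    (hXtail : ∀ i, (fun x : ℝ => μ.real {ω | x < X i ω}) ~[atTop] fun x => K * x ^ (-α))
    (ha : 0 < a) (ha' : 0 < a') :
    pairTail μ X a a' =O[atTop] fun x => x ^ (-(2 * α)) := by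
  unfold pairTail
  refine IsBigO.fun_sum fun b _ => IsBigO.fun_sum fun i _ => ?_
  split_ifs
  · exact isBigO_zero _ _
  · exact isBigO_mul hK (hXtail b) (hXtail i) ha ha'

/-- Let `b` be a largest variable. Either it dominates, and then `S > x` forces `X b` above `x / (c
+ D * ε)`, or a second variable exceeds `ε * X b`. Pairs with `c = 0` contribute nothing because
there `S` vanishes exactly. -/
theorem measureReal_le (hXindep : iIndepFun X μ) (hℓindep : IndepFun (fun ω i => X i ω) ℓ μ)
    (hℓunif : ∀ e, μ.real {ω | ℓ ω = e} = p) (hB : 0 < B) (hε : 0 < ε)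
    (hε1 : ε ≤ 1) (hc : ∀ b e, 0 ≤ c b e) (hD : 0 ≤ D)
    (hS : ∀ᵐ ω ∂μ, IsSingleJump X ℓ S c B D ε ω) {x : ℝ} (hx : 0 < x) :
    μ.real {ω | x < S ω} ≤
      (∑ b, ∑ e, if c b e = 0 then 0 else p * μ.real {ω | x / (c b e + D * ε) < X b ω}) +
        pairTail μ X (B / ε) (B / ε) x := by
  set A : ι → κ → Set Ω := fun b e => if c b e = 0 then ∅ else
    {ω | ℓ ω = e} ∩ {ω | x / (c b e + D * ε) < X b ω} with hA
  -- `x / (B / ε) = ε * (x / B)`: `S > x` implies `X b > x / B`, and a variable that spoils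
  -- dominance exceeds `ε` times that.
  set A' : ι → ι → Set Ω := fun b i => if i = b then ∅ else
    {ω | x / (B / ε) < X b ω} ∩ {ω | x / (B / ε) < X i ω} with hA'
  have hsub : {ω | x < S ω} ≤ᵐ[μ] ((⋃ b, ⋃ e, A b e) ∪ ⋃ b, ⋃ i, A' b i : Set Ω) := by
    filter_upwards [hS] with ω hω hxS
    obtain ⟨b, hb⟩ := Finite.exists_max fun i => X i ω
    have hxS' : x < S ω := hxS
    have hXb : x / B < X b ω := by
      rw [div_lt_iff₀ hB, mul_comm]
      exact hxS'.trans_le (hω.le b hb)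
    have hXb0 : 0 < X b ω := lt_trans (by positivity) hXb
    by_cases hdom : ∀ i, i ≠ b → X i ω ≤ ε * X b ω
    · left
      obtain ⟨h1, h2⟩ := hω.abs_sub_le b hXb0 hdom
      have hne : c b (ℓ ω) ≠ 0 := fun h0 => by linarith [h2 h0]
      have hpos : 0 < c b (ℓ ω) := lt_of_le_of_ne (hc _ _) hne.symm
      refine mem_iUnion.2 ⟨b, mem_iUnion.2 ⟨ℓ ω, ?_⟩⟩
      simp only [hA, if_neg hne]
      refine ⟨rfl, ?_⟩
      rw [mem_ofPred_eq]
      rw [div_lt_iff₀ (by positivity)]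
      linarith [(abs_le.1 h1).2]
    · right
      push Not at hdom
      obtain ⟨i, hib, hi⟩ := hdom
      refine mem_iUnion.2 ⟨b, mem_iUnion.2 ⟨i, ?_⟩⟩
      simp only [hA', if_neg hib]
      have e1 : x / (B / ε) = ε * (x / B) := by field_simp
      have e2 : ε * (x / B) < ε * X b ω := mul_lt_mul_of_pos_left hXb hε
      refine ⟨?_, ?_⟩
      · rw [mem_ofPred_eq]
        rw [e1]
        nlinarith
      · rw [mem_ofPred_eq]
        rw [e1]
        exact e2.trans hi
  have h1 : μ.real {ω | x < S ω} ≤ μ.real ((⋃ b, ⋃ e, A b e) ∪ ⋃ b, ⋃ i, A' b i) :=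
    ENNReal.toReal_mono (measure_ne_top _ _) (measure_mono_ae hsub)
  refine h1.trans ((measureReal_union_le _ _).trans (add_le_add ?_ ?_))
  · refine (measureReal_iUnion_fintype_le _).trans (Finset.sum_le_sum fun b _ => ?_)
    refine (measureReal_iUnion_fintype_le _).trans (Finset.sum_le_sum fun e _ => ?_)
    simp only [hA]
    split_ifs
    · simp
    · rw [measureReal_eq_inter hℓindep, hℓunif]
  · refine (measureReal_iUnion_fintype_le _).trans (Finset.sum_le_sum fun b _ => ?_)
    refine (measureReal_iUnion_fintype_le _).trans (Finset.sum_le_sum fun i _ => ?_)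
    simp only [hA']
    split_ifs with h
    · simp
    · rw [measureReal_inter_eq_mul hXindep (Ne.symm h)]

/-- The events that `b` dominates and `ℓ = e` are disjoint, since two variables cannot dominate each
other when `ε < 1`; so their probabilities add. Giving up the dominance costs only pair terms. Only
these events have to be measurable, not `{x < S}`. -/
theorem le_measureReal (hXmeas : ∀ i, Measurable (X i)) (hℓmeas : Measurable ℓ)
    (hXindep : iIndepFun X μ) (hℓindep : IndepFun (fun ω i => X i ω) ℓ μ)
    (hℓunif : ∀ e, μ.real {ω | ℓ ω = e} = p) (hε : 0 < ε)
    (hε1 : ε < 1) (hcD : ∀ b e, c b e ≠ 0 → D * ε < c b e)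
    (hS : ∀ᵐ ω ∂μ, IsSingleJump X ℓ S c B D ε ω) {x : ℝ} (hx : 0 < x) :
    (∑ b, ∑ e, if c b e = 0 then 0 else p * μ.real {ω | x / (c b e - D * ε) < X b ω}) -
      (∑ b, ∑ e, if c b e = 0 then 0 else
        pairTail μ X (c b e - D * ε) ((c b e - D * ε) / ε) x) ≤ μ.real {ω | x < S ω} := by
  set G : ι → Set Ω := fun b => {ω | 0 < X b ω ∧ ∀ i, i ≠ b → X i ω ≤ ε * X b ω} with hG
  set A : ι × κ → Set Ω := fun q => if c q.1 q.2 = 0 then ∅ else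
    ({ω | ℓ ω = q.2} ∩ {ω | x / (c q.1 q.2 - D * ε) < X q.1 ω}) ∩ G q.1 with hA
  have hGmeas : ∀ b, MeasurableSet (G b) := fun b => by
    have : ({ω | ∀ i, i ≠ b → X i ω ≤ ε * X b ω} : Set Ω) =
        ⋂ i, ⋂ (_ : i ≠ b), {ω | X i ω ≤ ε * X b ω} := by ext; simp
    have hm : MeasurableSet {ω | ∀ i, i ≠ b → X i ω ≤ ε * X b ω} := by
      rw [this]
      exact MeasurableSet.iInter fun i => MeasurableSet.iInter fun _ =>
        measurableSet_le (hXmeas i) ((hXmeas b).const_mul ε)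
    exact (measurableSet_lt measurable_const (hXmeas b)).inter hm
  have hAmeas : ∀ q, MeasurableSet (A q) := fun q => by
    simp only [hA]
    split_ifs
    · exact MeasurableSet.empty
    · exact ((hℓmeas (measurableSet_singleton _)).inter
        (measurableSet_lt measurable_const (hXmeas _))).inter (hGmeas _)
  have hdisj : Pairwise (Function.onFun Disjoint A) := by
    intro q q' hqq
    rw [Function.onFun, Set.disjoint_left]
    intro ω hω hω'
    simp only [hA] at hω hω'
    split_ifs at hω hω' with h1 h2
    · exact hω
    · exact hω
    · exact hω'
    obtain ⟨⟨hl, -⟩, hg⟩ := hω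
    obtain ⟨⟨hl', -⟩, hg'⟩ := hω'
    apply hqq
    refine Prod.ext ?_ (hl.symm.trans hl')
    by_contra hne
    have e1 := hg.2 _ (Ne.symm hne)
    have e2 := hg'.2 _ hne
    have e3 := hg.1
    have e4 := hg'.1
    nlinarith
  have hsub : (⋃ q, A q) ≤ᵐ[μ] {ω | x < S ω} := by
    filter_upwards [hS] with ω hω hmem
    obtain ⟨q, hq⟩ := mem_iUnion.1 hmem
    simp only [hA] at hq
    split_ifs at hq with h0
    · exact hq.elim
    obtain ⟨⟨hl, hX⟩, hg⟩ := hq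
    have hl' : ℓ ω = q.2 := hl
    have h1 := (hω.abs_sub_le q.1 hg.1 hg.2).1
    rw [hl'] at h1
    have hpos := hcD _ _ h0
    have hX' : x / (c q.1 q.2 - D * ε) < X q.1 ω := hX
    rw [div_lt_iff₀ (by linarith)] at hX'
    change x < S ω
    linarith [(abs_le.1 h1).1]
  have h1 : ∑ q, μ.real (A q) ≤ μ.real {ω | x < S ω} := by
    rw [← measureReal_iUnion_fintype hdisj hAmeas]
    exact ENNReal.toReal_mono (measure_ne_top _ _) (measure_mono_ae hsub)
  refine le_trans ?_ h1
  rw [Fintype.sum_prod_type, ← Finset.sum_sub_distrib]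
  refine Finset.sum_le_sum fun b _ => ?_
  rw [← Finset.sum_sub_distrib]
  refine Finset.sum_le_sum fun e _ => ?_
  simp only [hA]
  split_ifs with h0
  · simp
  set y := c b e - D * ε with hy
  have hy0 : 0 < y := by have := hcD _ _ h0; linarith
  rw [← hℓunif e, ← measureReal_eq_inter hℓindep, sub_le_iff_le_add]
  set Z : ι → Set Ω := fun i => if i = b then ∅ else
    {ω | x / y < X b ω} ∩ {ω | x / (y / ε) < X i ω} with hZ
  have hcover : {ω | ℓ ω = e} ∩ {ω | x / y < X b ω} ⊆
      ({ω | ℓ ω = e} ∩ {ω | x / y < X b ω} ∩ G b) ∪ ⋃ i, Z i := by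
    intro ω hω
    by_cases hg : ω ∈ G b
    · exact Or.inl ⟨hω, hg⟩
    · right
      have hX : x / y < X b ω := hω.2
      have hX0 : 0 < X b ω := lt_trans (by positivity) hX
      have hg' : ∃ i, i ≠ b ∧ ε * X b ω < X i ω := by
        by_contra hcon
        push Not at hcon
        exact hg ⟨hX0, hcon⟩
      obtain ⟨i, hib, hi⟩ := hg'
      refine mem_iUnion.2 ⟨i, ?_⟩
      simp only [hZ, if_neg hib]
      refine ⟨hX, ?_⟩
      rw [mem_ofPred_eq]
      have e1 : x / (y / ε) = ε * (x / y) := by field_simp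
      rw [e1]
      exact (mul_lt_mul_of_pos_left hX hε).trans hi
  refine (measureReal_mono hcover).trans ((measureReal_union_le _ _).trans ?_)
  gcongr
  refine (measureReal_iUnion_fintype_le _).trans ?_
  unfold pairTail
  refine le_trans (Finset.sum_le_sum fun i _ => ?_)
    (Finset.single_le_sum (f := fun b => ∑ i, if i = b then 0 else
      μ.real {ω | x / y < X b ω} * μ.real {ω | x / (y / ε) < X i ω})
      (fun b _ => Finset.sum_nonneg fun i _ => ?_) (Finset.mem_univ b))
  · simp only [hZ]
    split_ifs with h
    · simp
    · rw [measureReal_inter_eq_mul hXindep (Ne.symm h)]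
  · split_ifs
    · exact le_rfl
    · positivity

end BigJump

end RegularTail

/-! ### The limit of the rescaled tail -/

namespace RegularTail

section BigJumpLimit

variable {Ω ι κ : Type*} [MeasurableSpace Ω] {μ : Measure Ω} [IsProbabilityMeasure μ]
  [Fintype ι] [DecidableEq ι] [Nonempty ι] [Fintype κ] [DecidableEq κ] [MeasurableSpace κ]
  [MeasurableSingletonClass κ]
  {X : ι → Ω → ℝ} {ℓ : Ω → κ} {S : Ω → ℝ} {c : ι → κ → ℝ} {B D ε₀ p K α : ℝ}

/-- The limiting constant of the tail, with all the coefficients shifted by `η`. -/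
def tailConst (K α p : ℝ) (c : ι → κ → ℝ) (η : ℝ) : ℝ :=
  ∑ b, ∑ e, if c b e = 0 then 0 else p * (K * (c b e + η) ^ α)

theorem tendsto_tailConst (hα : 0 < α) (K p : ℝ) (c : ι → κ → ℝ) :
    Tendsto (tailConst K α p c) (𝓝 0) (𝓝 (tailConst K α p c 0)) := by
  unfold tailConst
  refine tendsto_finsetSum _ fun b _ => tendsto_finsetSum _ fun e _ => ?_
  split_ifs
  · exact tendsto_const_nhds
  · have : Continuous fun η : ℝ => p * (K * (c b e + η) ^ α) := by
      refine continuous_const.mul (continuous_const.mul ?_)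
      exact (continuous_const.add continuous_id).rpow_const fun _ => Or.inr hα.le
    exact this.tendsto 0

theorem tendsto_sum_tail (hK : 0 < K)
    (hXtail : ∀ i, (fun x : ℝ => μ.real {ω | x < X i ω}) ~[atTop] fun x => K * x ^ (-α)) {η : ℝ}
    (hη : ∀ b e, c b e ≠ 0 → 0 < c b e + η) :
    Tendsto (fun x => (∑ b, ∑ e, if c b e = 0 then 0 else
      p * μ.real {ω | x / (c b e + η) < X b ω}) * x ^ α) atTop (𝓝 (tailConst K α p c η)) := by
  simp only [Finset.sum_mul]
  refine tendsto_finsetSum _ fun b _ => tendsto_finsetSum _ fun e _ => ?_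
  split_ifs with h
  · simp
  · simp only [mul_assoc]
    exact (tendsto_mul_rpow hK (hXtail b) (hη b e h)).const_mul p

/-- The principle of a single big jump: the tail of `S` is the one that results when only one of
the variables is large. -/
theorem tendsto_measureReal_mul_rpow (hK : 0 < K) (hα : 0 < α)
    (hXmeas : ∀ i, Measurable (X i)) (hℓmeas : Measurable ℓ)
    (hXindep : iIndepFun X μ) (hℓindep : IndepFun (fun ω i => X i ω) ℓ μ)
    (hℓunif : ∀ e, μ.real {ω | ℓ ω = e} = p)
    (hXtail : ∀ i, (fun x : ℝ => μ.real {ω | x < X i ω}) ~[atTop] fun x => K * x ^ (-α))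
    (hc : ∀ b e, 0 ≤ c b e) (hB : 0 < B) (hD : 0 < D) (hε₀ : 0 < ε₀)
    (hS : ∀ ε ∈ Ioc 0 ε₀, ∀ᵐ ω ∂μ, IsSingleJump X ℓ S c B D ε ω) :
    Tendsto (fun x => μ.real {ω | x < S ω} * x ^ α) atTop (𝓝 (tailConst K α p c 0)) := by
  have hlim : Tendsto (fun ε : ℝ => D * ε) (𝓝[>] 0) (𝓝 0) := by
    have : Tendsto (fun ε : ℝ => D * ε) (𝓝 0) (𝓝 (D * 0)) := tendsto_id.const_mul D
    rw [mul_zero] at this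
    exact this.mono_left nhdsWithin_le_nhds
  have hlim' : Tendsto (fun ε : ℝ => -(D * ε)) (𝓝[>] 0) (𝓝 0) := by simpa using hlim.neg
  have hsmall : ∀ᶠ ε : ℝ in 𝓝[>] 0, 0 < ε ∧ ε < 1 ∧ ε ≤ ε₀ := by
    filter_upwards [self_mem_nhdsWithin, mem_nhdsWithin_of_mem_nhds (Iio_mem_nhds zero_lt_one),
      mem_nhdsWithin_of_mem_nhds (Iio_mem_nhds hε₀)] with ε h1 h2 h3
    exact ⟨h1, h2, le_of_lt h3⟩
  -- In both bounds `ε` is fixed first, so small that the constant shifted by `D * ε` is still on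
  -- the right side of `a`; then `x → ∞` removes the pair terms.
  refine tendsto_order.2 ⟨fun a ha => ?_, fun a ha => ?_⟩
  · have hcD : ∀ᶠ ε : ℝ in 𝓝[>] 0, ∀ b e, c b e ≠ 0 → D * ε < c b e := by
      refine eventually_all.2 fun b => eventually_all.2 fun e => ?_
      by_cases h0 : c b e = 0
      · simp [h0]
      · have hpos : 0 < c b e := lt_of_le_of_ne (hc b e) (Ne.symm h0)
        filter_upwards [hlim.eventually (Iio_mem_nhds hpos)] with ε hε _ using hε
    obtain ⟨ε, ⟨hε0, hε1, hεε⟩, hcDε, hεa⟩ := (hsmall.and (hcD.and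
      (((tendsto_tailConst hα K p c).comp hlim').eventually (lt_mem_nhds ha)))).exists
    have hpair : (fun x => ∑ b, ∑ e, if c b e = 0 then 0 else
        pairTail μ X (c b e - D * ε) ((c b e - D * ε) / ε) x) =O[atTop]
          fun x => x ^ (-(2 * α)) := by
      refine IsBigO.fun_sum fun b _ => IsBigO.fun_sum fun e _ => ?_
      split_ifs with h0
      · exact isBigO_zero _ _
      · have hpos : 0 < c b e - D * ε := sub_pos.2 (hcDε b e h0)
        exact isBigO_pairTail hK hXtail hpos (by positivity)
    have hT := (tendsto_sum_tail (p := p) hK hXtail (c := c) (η := -(D * ε))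
      fun b e h0 => by have := hcDε b e h0; linarith).sub
        (tendsto_mul_rpow_zero_of_isBigO hα hpair)
    rw [sub_zero] at hT
    filter_upwards [hT.eventually (lt_mem_nhds hεa), eventually_gt_atTop 0] with x hx hx0
    refine hx.trans_le ?_
    rw [← sub_mul]
    refine mul_le_mul_of_nonneg_right ?_ (by positivity)
    simpa only [← sub_eq_add_neg] using le_measureReal hXmeas hℓmeas hXindep hℓindep hℓunif hε0 hε1 hcDε
      (hS ε ⟨hε0, hεε⟩) hx0
  · obtain ⟨ε, ⟨hε0, hε1, hεε⟩, hεa⟩ := (hsmall.and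
      (((tendsto_tailConst hα K p c).comp hlim).eventually (gt_mem_nhds ha))).exists
    have hDε : 0 < D * ε := mul_pos hD hε0
    have hBε : 0 < B / ε := by positivity
    have hT := (tendsto_sum_tail (p := p) hK hXtail (c := c) (η := D * ε)
      fun b e _ => add_pos_of_nonneg_of_pos (hc b e) hDε).add
        (tendsto_mul_rpow_zero_of_isBigO hα (isBigO_pairTail hK hXtail hBε hBε))
    rw [add_zero] at hT
    filter_upwards [hT.eventually (gt_mem_nhds hεa), eventually_gt_atTop 0] with x hx hx0
    refine lt_of_le_of_lt ?_ hx
    rw [← add_mul]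
    refine mul_le_mul_of_nonneg_right ?_ (by positivity)
    exact measureReal_le hXindep hℓindep hℓunif hB hε0 hε1.le hc hD.le (hS ε ⟨hε0, hεε⟩) hx0

/-- With all coefficients zero only the pair term is left in the upper bound, and one fixed `ε`
suffices. -/
theorem isBigO_measureReal (hK : 0 < K)
    (hXindep : iIndepFun X μ) (hℓindep : IndepFun (fun ω i => X i ω) ℓ μ)
    (hℓunif : ∀ e, μ.real {ω | ℓ ω = e} = p)
    (hXtail : ∀ i, (fun x : ℝ => μ.real {ω | x < X i ω}) ~[atTop] fun x => K * x ^ (-α))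
    (hc : ∀ b e, c b e = 0) (hB : 0 < B) (hD : 0 < D) (hε₀ : 0 < ε₀)
    (hS : ∀ ε ∈ Ioc 0 ε₀, ∀ᵐ ω ∂μ, IsSingleJump X ℓ S c B D ε ω) :
    (fun x => μ.real {ω | x < S ω}) =O[atTop] fun x => x ^ (-(2 * α)) := by
  set ε := min ε₀ 1 with hε
  have hε0 : 0 < ε := lt_min hε₀ one_pos
  have hBε : 0 < B / ε := by positivity
  refine IsBigO.trans (IsBigO.of_bound 1 ?_) (isBigO_pairTail hK hXtail hBε hBε)
  filter_upwards [eventually_gt_atTop 0] with x hx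
  have h := measureReal_le hXindep hℓindep hℓunif hB hε0 (min_le_right _ _)
    (fun b e => (hc b e).ge) hD.le (hS ε ⟨hε0, min_le_left _ _⟩) hx
  simp only [hc, if_true, Finset.sum_const_zero, zero_add] at h
  rw [one_mul, Real.norm_of_nonneg measureReal_nonneg]
  exact h.trans (le_abs_self _)

end BigJumpLimit

end RegularTail

/-! ### Averaging over the dominant city and the first failure -/

namespace SixNode

open PowerNetwork

theorem isSingleJump (k : Fin 5) {lam : ℝ}
    (hlo : (endpoint k.castSucc : ℝ) / 8 < lam) (hhi : lam < (endpoint k.succ : ℝ) / 8) :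
    ∃ ε₀ > 0, ∀ ε ∈ Ioc 0 ε₀, ∀ {Ω : Type*} (X : Fin 2 ⊕ Fin 4 → Ω → ℝ) (ℓ : Ω → Fin 2 × Fin 4)
      (S : Ω → ℝ) (ω : Ω), (∀ i, 0 ≤ X i ω) →
      sixNode.IsBlackoutSize lam (fun i => X i ω) (ℓ ω) (S ω) →
        RegularTail.IsSingleJump X ℓ S (fun b l => lostNodes k b l * lam / 6) 24 30 ε ω := by
  have hlam : 0 < lam := lt_of_le_of_lt (by positivity) hlo
  obtain ⟨ε₀, hε₀, h⟩ := exists_abs_blackout_sub_le k hlo hhi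
  refine ⟨ε₀, hε₀, fun ε hε Ω X ℓ S ω hX hS => ⟨hX, fun b hb => blackout_le hlam hX hb hS,
    fun b hb hdom => ?_⟩⟩
  obtain ⟨h1, h2⟩ := h ε hε (fun i => X i ω) b hX hb hdom (ℓ ω) (S ω) hS
  refine ⟨h1, fun h0 => h2 ?_⟩
  have : (lostNodes k b (ℓ ω) : ℝ) = 0 := by
    rcases div_eq_zero_iff.1 h0 with h0 | h0
    · exact (mul_eq_zero.1 h0).resolve_right hlam.ne'
    · norm_num at h0
  exact_mod_cast this

/-- The 48 pairs are counted by the number of lost nodes. They fall into four classes: the city is a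
hub and the line is at it (8) or not (8); the city is a leaf and the line is at it (8) or not (24).
-/
theorem sum_comp_lostNodes (k : Fin 5) (f : ℕ → ℝ) : ∑ b, ∑ l, f (lostNodes k b l) =
    (![48, 40, 32, 8, 0] k : ℕ) * f 0 + (![0, 8, 8, 32, 32] k : ℕ) * f 1 +
      (![0, 0, 0, 0, 8] k : ℕ) * f 2 + (![0, 0, 8, 8, 8] k : ℕ) * f 4 := by
  have hmem : ∀ (k : Fin 5) b l, lostNodes k b l ∈ ({0, 1, 2, 4} : Finset ℕ) := by decide
  have hcount : ∀ (k : Fin 5),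
      (Finset.univ.filter fun q : (Fin 2 ⊕ Fin 4) × Fin 2 × Fin 4 => lostNodes k q.1 q.2 = 0).card =
        ![48, 40, 32, 8, 0] k ∧
      (Finset.univ.filter fun q : (Fin 2 ⊕ Fin 4) × Fin 2 × Fin 4 => lostNodes k q.1 q.2 = 1).card =
        ![0, 8, 8, 32, 32] k ∧
      (Finset.univ.filter fun q : (Fin 2 ⊕ Fin 4) × Fin 2 × Fin 4 => lostNodes k q.1 q.2 = 2).card =
        ![0, 0, 0, 0, 8] k ∧
      (Finset.univ.filter fun q : (Fin 2 ⊕ Fin 4) × Fin 2 × Fin 4 => lostNodes k q.1 q.2 = 4).card =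
        ![0, 0, 8, 8, 8] k := by decide
  obtain ⟨h0, h1, h2, h4⟩ := hcount k
  rw [← h0, ← h1, ← h2, ← h4, ← Fintype.sum_prod_type (f := fun q => f (lostNodes k q.1 q.2)),
    ← Finset.sum_fiberwise_of_maps_to (g := fun q : (Fin 2 ⊕ Fin 4) × Fin 2 × Fin 4 =>
      lostNodes k q.1 q.2) (fun q _ => hmem k q.1 q.2)]
  have : ∀ n, ∑ q : (Fin 2 ⊕ Fin 4) × Fin 2 × Fin 4 with lostNodes k q.1 q.2 = n,
      f (lostNodes k q.1 q.2) =
      (Finset.univ.filter fun q : (Fin 2 ⊕ Fin 4) × Fin 2 × Fin 4 => lostNodes k q.1 q.2 = n).card *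
        f n := fun n => by
    rw [Finset.sum_congr rfl fun q hq => by rw [(Finset.mem_filter.1 hq).2], Finset.sum_const,
      nsmul_eq_mul]
  simp only [this]
  simp [add_assoc]

end SixNode

theorem SixNode.endpoint_castSucc (k : Fin 5) :
    SixNode.endpoint k.castSucc = ![0, 2, 3, 4, 6] k := by
  revert k; decide

theorem SixNode.endpoint_succ (k : Fin 5) : SixNode.endpoint k.succ = ![2, 3, 4, 6, 8] k := by
  revert k; decide

/-! ### Phase transitions of the prefactor -/

theorem exists_tendsto_nhdsNE_iff {f g h : ℝ → ℝ} {t : ℝ} (hg : ContinuousAt g t)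
    (hh : ContinuousAt h t) (hl : f =ᶠ[𝓝[<] t] g) (hr : f =ᶠ[𝓝[>] t] h) :
    (∃ c, Tendsto f (𝓝[≠] t) (𝓝 c)) ↔ g t = h t := by
  have hl' : Tendsto f (𝓝[<] t) (𝓝 (g t)) := (hg.mono_left nhdsWithin_le_nhds).congr' hl.symm
  have hr' : Tendsto f (𝓝[>] t) (𝓝 (h t)) := (hh.mono_left nhdsWithin_le_nhds).congr' hr.symm
  rw [← Iio_union_Ioi, nhdsWithin_union]
  constructor
  · rintro ⟨c, hc⟩
    rw [tendsto_sup] at hc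
    exact (tendsto_nhds_unique hl' hc.1).trans (tendsto_nhds_unique hr' hc.2).symm
  · intro heq
    exact ⟨g t, hl'.sup (heq ▸ hr')⟩

section PhaseTransition

variable {α lam t : ℝ}

/-- The expression for the prefactor on the `k`-th interval. -/
def sixNodePiece (α : ℝ) (k : Fin 5) (lam : ℝ) : ℝ :=
  (![0, 1, 1, 4, 4] k : ℕ) * (lam / 6) ^ α + (![0, 0, 0, 0, 1] k : ℕ) * (lam / 3) ^ α +
    (![0, 0, 1, 1, 1] k : ℕ) * (2 * lam / 3) ^ α

theorem continuousAt_sixNodePiece (hα : 0 < α) (k : Fin 5) (t : ℝ) :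
    ContinuousAt (sixNodePiece α k) t := by
  have h : ∀ a : ℝ, Continuous fun lam : ℝ => (a * lam) ^ α := fun a =>
    (continuous_const.mul continuous_id).rpow_const fun _ => Or.inr hα.le
  have h1 := ((continuous_const (y := ((![0, 1, 1, 4, 4] k : ℕ) : ℝ))).mul (h (1 / 6))).add
    ((continuous_const (y := ((![0, 0, 0, 0, 1] k : ℕ) : ℝ))).mul (h (1 / 3)))
  have h2 := h1.add ((continuous_const (y := ((![0, 0, 1, 1, 1] k : ℕ) : ℝ))).mul (h (2 / 3)))
  refine (h2.congr fun lam => ?_).continuousAt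
  simp only [Pi.add_apply, Pi.mul_apply, sixNodePiece]
  ring_nf

theorem sixNodePrefactor_eq_piece (k : Fin 5) (hlo : (SixNode.endpoint k.castSucc : ℝ) / 8 < lam)
    (hhi : lam < (SixNode.endpoint k.succ : ℝ) / 8) :
    sixNodePrefactor α lam = sixNodePiece α k lam := by
  revert hlo hhi
  rw [sixNodePrefactor, SixNode.endpoint_castSucc, SixNode.endpoint_succ, sixNodePiece]
  fin_cases k <;> simp <;> intro h1 h2
  · intro h3
    linarith
  · rw [if_neg (by linarith), if_pos (by linarith)]
  · rw [if_neg (by linarith), if_neg (by linarith), if_pos (by linarith)]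
  · rw [if_neg (by linarith), if_neg (by linarith), if_neg (by linarith), if_pos (by linarith)]
  · rw [if_neg (by linarith), if_neg (by linarith), if_neg (by linarith), if_neg (by linarith)]

theorem exists_tendsto_sixNodePrefactor_iff (hα : 0 < α) (k k' : Fin 5)
    (hlo : (SixNode.endpoint k.castSucc : ℝ) / 8 < t) (hhi : t ≤ (SixNode.endpoint k.succ : ℝ) / 8)
    (hlo' : (SixNode.endpoint k'.castSucc : ℝ) / 8 ≤ t)
    (hhi' : t < (SixNode.endpoint k'.succ : ℝ) / 8) :
    (∃ c, Tendsto (sixNodePrefactor α) (𝓝[≠] t) (𝓝 c)) ↔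
      sixNodePiece α k t = sixNodePiece α k' t := by
  refine exists_tendsto_nhdsNE_iff (continuousAt_sixNodePiece hα k t)
    (continuousAt_sixNodePiece hα k' t) ?_ ?_
  · filter_upwards [Ioo_mem_nhdsLT hlo] with lam h
    exact sixNodePrefactor_eq_piece k h.1 (h.2.trans_le hhi)
  · filter_upwards [Ioo_mem_nhdsGT hhi'] with lam h
    exact sixNodePrefactor_eq_piece k' (hlo'.trans_lt h.1) h.2

theorem exists_mem_Ioo_endpoint (ht : t ∈ Ioo (0 : ℝ) 1)
    (h : ¬ (t = 1 / 4 ∨ t = 3 / 8 ∨ t = 1 / 2 ∨ t = 3 / 4)) :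
    ∃ k : Fin 5, (SixNode.endpoint k.castSucc : ℝ) / 8 < t ∧
      t < (SixNode.endpoint k.succ : ℝ) / 8 := by
  push Not at h
  obtain ⟨h0, h1⟩ := ht
  rcases lt_or_gt_of_ne h.1 with h2 | h2
  · exact ⟨0, by rw [SixNode.endpoint_castSucc]; simp only [Matrix.cons_val]; push_cast; linarith,
      by rw [SixNode.endpoint_succ]; simp only [Matrix.cons_val]; push_cast; linarith⟩
  rcases lt_or_gt_of_ne h.2.1 with h3 | h3
  · exact ⟨1, by rw [SixNode.endpoint_castSucc]; simp only [Matrix.cons_val]; push_cast; linarith,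
      by rw [SixNode.endpoint_succ]; simp only [Matrix.cons_val]; push_cast; linarith⟩
  rcases lt_or_gt_of_ne h.2.2.1 with h4 | h4
  · exact ⟨2, by rw [SixNode.endpoint_castSucc]; simp only [Matrix.cons_val]; push_cast; linarith,
      by rw [SixNode.endpoint_succ]; simp only [Matrix.cons_val]; push_cast; linarith⟩
  rcases lt_or_gt_of_ne h.2.2.2 with h5 | h5
  · exact ⟨3, by rw [SixNode.endpoint_castSucc]; simp only [Matrix.cons_val]; push_cast; linarith,
      by rw [SixNode.endpoint_succ]; simp only [Matrix.cons_val]; push_cast; linarith⟩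
  · exact ⟨4, by rw [SixNode.endpoint_castSucc]; simp only [Matrix.cons_val]; push_cast; linarith,
      by rw [SixNode.endpoint_succ]; simp only [Matrix.cons_val]; push_cast; linarith⟩

/-- At each threshold the right piece exceeds the left one by a positive amount: `(t/6)^α`,
`(2t/3)^α`, `3 (t/6)^α` and `(t/3)^α` in turn. -/
theorem not_exists_tendsto_sixNodePrefactor_iff (hα : 0 < α) (ht : t ∈ Ioo (0 : ℝ) 1) :
    (¬ ∃ c, Tendsto (sixNodePrefactor α) (𝓝[≠] t) (𝓝 c)) ↔
      t = 1 / 4 ∨ t = 3 / 8 ∨ t = 1 / 2 ∨ t = 3 / 4 := by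
  constructor
  · intro hn
    by_contra hcon
    obtain ⟨k, h1, h2⟩ := exists_mem_Ioo_endpoint ht hcon
    exact hn ((exists_tendsto_sixNodePrefactor_iff hα k k h1 h2.le h1.le h2).2 rfl)
  · have h6 := Real.rpow_pos_of_pos (show 0 < t / 6 by linarith [ht.1]) α
    have h3 := Real.rpow_pos_of_pos (show 0 < t / 3 by linarith [ht.1]) α
    have h23 := Real.rpow_pos_of_pos (show 0 < 2 * t / 3 by linarith [ht.1]) α
    rintro (h | h | h | h)
    · rw [exists_tendsto_sixNodePrefactor_iff hα 0 1]
      rotate_left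
      iterate 4
        simp only [SixNode.endpoint_castSucc, SixNode.endpoint_succ, Matrix.cons_val]
        push_cast
        linarith
      simp only [sixNodePiece, Matrix.cons_val]
      push_cast
      intro h'
      linarith
    · rw [exists_tendsto_sixNodePrefactor_iff hα 1 2]
      rotate_left
      iterate 4
        simp only [SixNode.endpoint_castSucc, SixNode.endpoint_succ, Matrix.cons_val]
        push_cast
        linarith
      simp only [sixNodePiece, Matrix.cons_val]
      push_cast
      intro h'
      linarith
    · rw [exists_tendsto_sixNodePrefactor_iff hα 2 3]
      rotate_left
      iterate 4
        simp only [SixNode.endpoint_castSucc, SixNode.endpoint_succ, Matrix.cons_val]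
        push_cast
        linarith
      simp only [sixNodePiece, Matrix.cons_val]
      push_cast
      intro h'
      linarith
    · rw [exists_tendsto_sixNodePrefactor_iff hα 3 4]
      rotate_left
      iterate 4
        simp only [SixNode.endpoint_castSucc, SixNode.endpoint_succ, Matrix.cons_val]
        push_cast
        linarith
      simp only [sixNodePiece, Matrix.cons_val]
      push_cast
      intro h'
      linarith

end PhaseTransition

/-! ### Identification of the constant and conclusion -/

theorem tailConst_lostNodes {α : ℝ} (hα : 0 < α) (K : ℝ) (k : Fin 5) (lam : ℝ) :
    RegularTail.tailConst K α (1 / 8) (fun b l => (SixNode.lostNodes k b l : ℝ) * lam / 6) 0 =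
      sixNodePiece α k lam * K := by
  have h : RegularTail.tailConst K α (1 / 8)
      (fun b l => (SixNode.lostNodes k b l : ℝ) * lam / 6) 0 =
      ∑ b, ∑ l, (fun n : ℕ => 1 / 8 * (K * (n * lam / 6) ^ α)) (SixNode.lostNodes k b l) := by
    rw [RegularTail.tailConst]
    refine Finset.sum_congr rfl fun b _ => Finset.sum_congr rfl fun l _ => ?_
    -- The terms omitted for vanishing coefficients are zero anyway, since `0 ^ α = 0` for `α > 0`.
    split_ifs with h0
    · simp only [h0, Real.zero_rpow hα.ne', mul_zero]
    · rw [add_zero]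
  rw [h, SixNode.sum_comp_lostNodes k fun n : ℕ => 1 / 8 * (K * (n * lam / 6) ^ α), sixNodePiece]
  have e2 : (2 : ℝ) * lam / 6 = lam / 3 := by ring
  have e4 : (4 : ℝ) * lam / 6 = 2 * lam / 3 := by ring
  push_cast
  rw [e2, e4, zero_mul, zero_div, Real.zero_rpow hα.ne', one_mul]
  fin_cases k <;> simp <;> ring

theorem isEquivalent_of_tendsto_mul_rpow {α C : ℝ} (hC : 0 < C) {f : ℝ → ℝ}
    (hf : Tendsto (fun x => f x * x ^ α) atTop (𝓝 C)) :
    f ~[atTop] fun x => C * x ^ (-α) := by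
  have hne : ∀ᶠ x : ℝ in atTop, C * x ^ (-α) ≠ 0 := by
    filter_upwards [eventually_gt_atTop 0] with x hx
    positivity
  refine (isEquivalent_iff_tendsto_one hne).2 ?_
  have h := hf.div_const C
  rw [div_self hC.ne'] at h
  refine h.congr' ?_
  filter_upwards [eventually_gt_atTop 0] with x hx
  have := Real.rpow_pos_of_pos hx α
  rw [Pi.div_apply, Real.rpow_neg hx.le]
  field_simp

theorem sixNodePiece_pos (α : ℝ) {k : Fin 5} (hk : k ≠ 0) {lam : ℝ} (hlam : 0 < lam) :
    0 < sixNodePiece α k lam := by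
  rw [sixNodePiece]
  have : 0 < (![0, 1, 1, 4, 4] k : ℕ) := by revert k; decide
  positivity

end

theorem mainTheorem4 {Ω : Type*} [MeasurableSpace Ω] (μ : Measure Ω) [IsProbabilityMeasure μ]
    (K α : ℝ) (hK : 0 < K) (hα : 0 < α)
    (X : Fin 2 ⊕ Fin 4 → Ω → ℝ) (ℓ : Ω → Fin 2 × Fin 4)
    (hXmeas : ∀ i, Measurable (X i)) (hXnonneg : ∀ i, ∀ᵐ ω ∂μ, 0 ≤ X i ω)
    (hXindep : iIndepFun X μ) (hXident : ∀ i j, IdentDistrib (X i) (X j) μ μ)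
    (hXtail : ∀ i, (fun x : ℝ => μ.real {ω | x < X i ω}) ~[atTop] fun x => K * x ^ (-α))
    (hℓmeas : Measurable ℓ) (hℓunif : ∀ e, μ.real {ω | ℓ ω = e} = 1 / 8)
    (hℓindep : IndepFun (fun ω i => X i ω) ℓ μ) :
    (∀ lam ∈ Ioo (0 : ℝ) (1 / 4), ∀ S : Ω → ℝ,
      (∀ᵐ ω ∂μ, sixNode.IsBlackoutSize lam (fun i => X i ω) (ℓ ω) (S ω)) →
      (fun x : ℝ => μ.real {ω | x < S ω}) =O[atTop] fun x => x ^ (-(2 * α))) ∧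
    (∀ lam ∈ Ioo (1 / 4 : ℝ) (3 / 8) ∪ Ioo (3 / 8) (1 / 2) ∪ Ioo (1 / 2) (3 / 4) ∪ Ioo (3 / 4) 1,
      ∀ S : Ω → ℝ,
      (∀ᵐ ω ∂μ, sixNode.IsBlackoutSize lam (fun i => X i ω) (ℓ ω) (S ω)) →
      (fun x : ℝ => μ.real {ω | x < S ω}) ~[atTop]
        fun x => sixNodePrefactor α lam * K * x ^ (-α)) ∧
    (∀ t ∈ Ioo (0 : ℝ) 1,
      (¬ ∃ c, Tendsto (sixNodePrefactor α) (𝓝[≠] t) (𝓝 c)) ↔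
        t = 1 / 4 ∨ t = 3 / 8 ∨ t = 1 / 2 ∨ t = 3 / 4) := by
  have hX0 : ∀ᵐ ω ∂μ, ∀ i, 0 ≤ X i ω := ae_all_iff.2 hXnonneg
  refine ⟨fun lam hlam S hS => ?_, fun lam hlam S hS => ?_, fun t ht =>
    not_exists_tendsto_sixNodePrefactor_iff hα ht⟩
  · obtain ⟨ε₀, hε₀, h⟩ := SixNode.isSingleJump (0 : Fin 5) (lam := lam)
      (by
        simp only [SixNode.endpoint_castSucc, Matrix.cons_val]
        push_cast; linarith [hlam.1])
      (by
        simp only [SixNode.endpoint_succ, Matrix.cons_val]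
        push_cast; linarith [hlam.2])
    refine RegularTail.isBigO_measureReal (B := 24) (D := 30)
      (c := fun b l => (SixNode.lostNodes 0 b l : ℝ) * lam / 6) hK hXindep hℓindep hℓunif hXtail
      (fun b l => ?_) (by norm_num) (by norm_num) hε₀ fun ε hε => ?_
    -- Below `1/4` no first failure cuts off a node from a dominant city, so no term of order `x ^
    -- (-α)` arises.
    · have : SixNode.lostNodes 0 b l = 0 := by revert b l; decide
      rw [this]
      simp
    · filter_upwards [hX0, hS] with ω h1 h2 using h ε hε X ℓ S ω h1 h2
  · have hlam01 : lam ∈ Ioo (0 : ℝ) 1 := by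
      rcases hlam with ((h | h) | h) | h <;> exact ⟨by linarith [h.1], by linarith [h.2]⟩
    obtain ⟨k, hlo, hhi⟩ := exists_mem_Ioo_endpoint hlam01 (by
      rcases hlam with ((h | h) | h) | h <;> obtain ⟨h1, h2⟩ := h <;>
        rintro (h | h | h | h) <;> linarith)
    have hk : k ≠ 0 := by
      rintro rfl
      have h1 : lam < 1 / 4 := by
        simp only [SixNode.endpoint_succ, Matrix.cons_val] at hhi
        push_cast at hhi; linarith
      rcases hlam with ((h | h) | h) | h <;> linarith [h.1]
    obtain ⟨ε₀, hε₀, h⟩ := SixNode.isSingleJump k hlo hhi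
    have hlim := RegularTail.tendsto_measureReal_mul_rpow (B := 24) (D := 30)
      (c := fun b l => (SixNode.lostNodes k b l : ℝ) * lam / 6) (S := S) hK hα hXmeas hℓmeas
      hXindep hℓindep hℓunif hXtail
      (fun b l => by have := hlam01.1; positivity) (by norm_num) (by norm_num) hε₀ fun ε hε => by
        filter_upwards [hX0, hS] with ω h1 h2 using h ε hε X ℓ S ω h1 h2
    rw [tailConst_lostNodes hα] at hlim
    rw [sixNodePrefactor_eq_piece k hlo hhi]
    exact isEquivalent_of_tendsto_mul_rpow (mul_pos (sixNodePiece_pos α hk hlam01.1) hK) hlim
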